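/- \textbf{Definitions.} Let $\alpha\ge 0$, $c\ge 1$, $\beta\ge 0$ be integers. An \emph{$\alpha$-arbdefective $c$-colored $\beta$-ruling set} of a graph $G=(V,E)$ is a set $S\subseteq V$ together with a coloring $\varphi:S\to\{1,\dots,c\}$ and an orientation of the edges of $G$ between nodes of $S$, such that every $v\in S$ has at most $\alpha$ outneighbors $u\in S$ with $\varphi(u)=\varphi(v)$, and every $v\in V\setminus S$ has a node of $S$ at distance at most $\beta$. In the LOCAL model with identifier exponent $\kappa$, the nodes of an $n$-node graph with maximum degree $\Delta$ have distinct identifiers in $\{1,\dots,n^\kappa\}$, and the edges incident to each node are numbered arbitrarily by ports. Each node initially knows its identifier, its degree, and all parameters $n,\Delta,\alpha,c,\beta,\kappa$. In each synchronous round every node exchanges messages of unbounded size with its neighbors and performs unbounded local computation. After $T$ rounds every node outputs whether it is in $S$, its color if so, and the orientation of its incident edges. A deterministic algorithm must be correct for all graphs of the class considered, all identifiers and all port numberings. In the randomized model every node also has its own independent stream of fair random bits, and on each instance the output must be correct with probability at least $1-1/n$. A \emph{$\Delta$-regular tree} is a finite tree in which every node has degree $1$ or $\Delta$. \textbf{Theorem.}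 There are absolute constants $\varepsilon>0$, $C$ and $\kappa_0$ such that the following holds for all integers $\kappa\ge\kappa_0$, $\Delta\ge 2$, $\alpha\ge 0$, $c\ge 1$, $\beta\ge 0$ and $n\ge 2$. Let $t$ be the largest integer $t\ge 0$ with $\binom{t+\beta}{\beta}<\frac{\Delta}{c(\alpha+1)}$, where $t=\infty$ if this holds for all integers $t\ge 0$ (which can happen only for $\beta=0$), and $t=0$ if it holds for none. Let $\mathcal G$ be a class of $n$-node graphs that contains - all $n$-node trees of maximum degree exactly $\Delta$, or - all $n$-node $\Delta$-regular trees, where in this case $n$ is such that at least one exists. Then, in the LOCAL model with identifier exponent $\kappa$: 1. If a deterministic algorithm computes an $\alpha$-arbdefective $c$-colored $\beta$-ruling set on every graph of $\mathcal G$ in $T$ rounds, then $T\ge\varepsilon\,(\min\{t,\log_\Delta n\}-\beta)$, provided that $\min\{t,\log_\Delta n\}-\beta\ge C$. 2. If a randomized algorithm does so in $T$ rounds, then $T\ge\varepsilon\,(\min\{t,\log_\Delta\log n\}-\beta)$, provided that $\min\{t,\log_\Delta\log n\}-\beta\ge C$. In other words, the problem requires $\Omega(\min\{t,\log_\Delta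 n\}-\beta)$ rounds in the deterministic and $\Omega(\min\{t,\log_\Delta\log n\}-\beta)$ rounds in the randomized LOCAL model, with constants that do not depend on $\Delta,\alpha,c,\beta,n$, and this holds already on $\Delta$-regular trees. -/

import Mathlib

open MeasureTheory
open scoped ENNReal

/-! ### Graph classes -/

/-- The maximum degree of `G` is `Δ` (and it is attained). -/
def HasMaxDegree {V : Type} (G : SimpleGraph V) (Δ : ℕ) : Prop :=
  (∀ v, (G.neighborSet v).encard ≤ Δ) ∧ ∃ v, (G.neighborSet v).encard = Δ

/-- A (finite) `Δ`-regular tree: a tree all of whose vertices that are not leaves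
have degree exactly `Δ`. -/
def IsRegularTree {V : Type} (G : SimpleGraph V) (Δ : ℕ) : Prop :=
  G.IsTree ∧ ∀ v, (G.neighborSet v).encard = 1 ∨ (G.neighborSet v).encard = Δ

/-! ### The problem -/

/-- `α`-arbdefective `c`-colored `β`-ruling sets of `G`. The set is
`S = {v | col v ≠ none}`, the color of `v ∈ S` is the value of `col v`, and `out u v`
says that the edge `{u, v}` is oriented from `u` to `v`. -/
structure IsArbdefectiveColoredRulingSet {V : Type} (G : SimpleGraph V) (α c β : ℕ)
    (col : V → Option (Fin c)) (out : V → V → Prop) : Prop where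
  /-- every edge between two vertices of `S` is oriented in exactly one direction -/
  oriented : ∀ u v, G.Adj u v → col u ≠ none → col v ≠ none → Xor (out u v) (out v u)
  /-- a vertex of color `x` has at most `α` outneighbors of color `x` -/
  arbdefect : ∀ v x, col v = some x →
    {u | G.Adj v u ∧ out v u ∧ col u = some x}.encard ≤ α
  /-- every vertex outside of `S` has a vertex of `S` at distance at most `β` -/
  dominated : ∀ v, col v = none → ∃ u, col u ≠ none ∧ ∃ p : G.Walk v u, p.length ≤ β

/-! ### The LOCAL model -/

/-- A communication network on `n` nodes: a graph, at every node `v` a numbering of the incident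
edges by the ports `0, …, deg v - 1` (so `deg v` is the degree of `v`), and unique
positive identifiers. -/
structure Network (n : ℕ) where
  graph : SimpleGraph (Fin n)
  deg : Fin n → ℕ
  port : (v : Fin n) → Fin (deg v) ≃ graph.neighborSet v
  ident : Fin n → ℕ
  ident_injective : Function.Injective ident
  ident_pos : ∀ v, 1 ≤ ident v

namespace Network

variable {n : ℕ} (N : Network n)

/-- The neighbor of `v` behind port `i`. -/
def nbr (v : Fin n) (i : Fin (N.deg v)) : Fin n := (N.port v i).1

/-- The port by which the neighbor of `v` behind port `i` is connected to `v`. -/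
def revPort (v : Fin n) (i : Fin (N.deg v)) : Fin (N.deg (N.nbr v i)) :=
  (N.port (N.nbr v i)).symm ⟨v, (N.graph.mem_neighborSet _ _).2 (N.port v i).2.symm⟩

end Network

/-- A synchronous message passing algorithm, executed by all nodes. `In` is the type of what a
node knows initially, `Out` is the type of its output. There is no bound on the local memory, on
the size of the messages, or on the local computations. -/
structure LocalAlgorithm (In Out : Type) where
  State : Type
  Msg : Type
  init : In → State
  /-- the message sent through the given port -/
  send : State → ℕ → Msg
  /-- the new state of a node of the given degree, from the messages received through its ports -/
  receive : (d : ℕ) → State → (Fin d → Msg) → State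
  output : State → Out

namespace LocalAlgorithm

variable {In Out : Type} (A : LocalAlgorithm In Out) {n : ℕ} (N : Network n) (inp : Fin n → In)

/-- The states of the nodes after the given number of rounds. -/
def stateAfter : ℕ → Fin n → A.State
  | 0, v => A.init (inp v)
  | T + 1, v => A.receive (N.deg v) (stateAfter T v)
      fun i => A.send (stateAfter T (N.nbr v i)) (N.revPort v i)

/-- The outputs of the nodes after the given number of rounds. -/
def outputAfter (T : ℕ) (v : Fin n) : Out := A.output (A.stateAfter N inp T v)

end LocalAlgorithm

/-- What a node outputs: whether it is in the set, its color if so, and the ports whose edges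
it orients away from itself. -/
structure NodeOutput (c : ℕ) where
  color : Option (Fin c)
  out : ℕ → Bool

/-- The outputs of the nodes form an `α`-arbdefective `c`-colored `β`-ruling set of the network. -/
def Network.IsSolution {n : ℕ} (N : Network n) (α c β : ℕ) (o : Fin n → NodeOutput c) : Prop :=
  IsArbdefectiveColoredRulingSet N.graph α c β (fun v => (o v).color)
    (fun u v => ∃ i : Fin (N.deg u), N.nbr u i = v ∧ (o u).out i = true)

/-- Some deterministic algorithm computes, within `T` rounds, an `α`-arbdefective
`c`-colored `β`-ruling set on all networks whose graph is in the class `𝒢` of `n`-vertex graphs and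
whose identifiers are in `{1, …, n ^ κ}`. A node initially knows its identifier and its degree
(the algorithm may depend on `n` and on all the other parameters). -/
def DetSolvable {n : ℕ} (𝒢 : SimpleGraph (Fin n) → Prop) (κ α c β T : ℕ) : Prop :=
  ∃ A : LocalAlgorithm (ℕ × ℕ) (NodeOutput c), ∀ N : Network n,
    𝒢 N.graph → (∀ v, N.ident v ≤ n ^ κ) →
      N.IsSolution α c β (A.outputAfter N (fun v => (N.ident v, N.deg v)) T)

/-- The law of independent streams of independent fair random bits, one stream for every node. -/
noncomputable def randomBits (n : ℕ) : Measure (Fin n → ℕ → Bool) :=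
  Measure.pi fun _ => Measure.infinitePi fun _ => (PMF.uniformOfFintype Bool).toMeasure

/-- As `DetSolvable`, but every node also has a stream of random bits, and on each network
the algorithm may fail with probability at most `1 / n`. -/
def RandSolvable {n : ℕ} (𝒢 : SimpleGraph (Fin n) → Prop) (κ α c β T : ℕ) : Prop :=
  ∃ A : LocalAlgorithm (ℕ × ℕ × (ℕ → Bool)) (NodeOutput c), ∀ N : Network n,
    𝒢 N.graph → (∀ v, N.ident v ≤ n ^ κ) →
      randomBits n {ω | ¬ N.IsSolution α c β
        (A.outputAfter N (fun v => (N.ident v, N.deg v, ω v)) T)} ≤ (n : ℝ≥0∞)⁻¹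

/-! ### The bound -/

/-- The largest `t` with `(t + β).choose β < Δ / (c * (α + 1))`, where `⊤` means that all `t`
satisfy this (which happens only for `β = 0`); it is `0` if there is no such `t`. -/
noncomputable def largestT (Δ α c β : ℕ) : ℕ∞ :=
  ⨆ t ∈ {t : ℕ | ((t + β).choose β : ℝ) < (Δ : ℝ) / (c * (α + 1))}, (t : ℕ∞)

/-- `min {t, x}` for `t ∈ {0, 1, …, ∞}` and a real number `x`. -/
noncomputable def minReal (t : ℕ∞) (x : ℝ) : ℝ :=
  if t = ⊤ then x else min (t.toNat : ℝ) x

/-! The proof is round elimination on the infinite `Δ`-regular tree with a proper edge colouring,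
where identifiers are governed by an ID graph: relations `H i` on the set of identifiers that say
which pairs may sit at the two ends of an edge of colour `i`. Since this constraint is local, labels
in different branches can be chosen independently, and round elimination works in the presence of
identifiers.

The ruling set problem is first relaxed to one with colours and pointers. A node of colour `a`
claims `α + 1` copies of `a` at every edge except those to outneighbours of the same colour. At most
`α` edges are excepted, so the copies cannot be matched injectively to edges at which they are not
claimed. A node outside the set points to a neighbour that is closer to the set; the levels record
distances up to `β`. Computing them costs `β + 1` extra rounds, which is the source of the term
`-β`.

One elimination step (`Solves.exists_step`, with combinatorial core `nodeOk_common`) saves a round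
and gives a problem of the same form, whose colours are the old ones promoted to a level between
their own and `β`. The number of colours of level at most `j` is replaced by a sum over all levels
up to `j`, so `s` steps lead to at most `c * (α + 1) * (s + j).choose j` of them
(`card_promoted_le`). While there are at most `Δ` colours, zero rounds do not suffice
(`not_solves_zero`): give every colour its own edge; each identifier then commits to a claim or a
pointer at a definite edge, and two identifiers joined by the ID graph along that edge with the same
commitment contradict each other.

`exists_idGraph` constructs the ID graph by the probabilistic method. Having edges of every colour
in all large sets gives the pigeonhole property above; the absence of short cycles makes the labels
in a ball distinct (`IsLabelling.eq_of_eq`), so that they are legitimate identifiers. A ball of the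
infinite tree is then completed to a tree on exactly `n` vertices with edge colours as ports
(`exists_host`), and `exists_not_isSolution` transfers the bound to the LOCAL model. For randomized
algorithms, the random bits are attached to identifiers instead of nodes. Each outcome of the bits
yields a deterministic rule that fails on some labelling of the ball, but there are fewer than `n`
such labellings and each fails with probability at most `1 / n`. -/

/-! ### Words and labellings of the edge-coloured regular tree -/

namespace RegTree

variable {Δ : ℕ} {V : Type}

/-- Reduced words over the edge colours are the vertices of the infinite `Δ`-regular tree with a
proper edge colouring: a vertex is given by the colours on the path from the root to it. -/
abbrev Reduced (w : List (Fin Δ)) : Prop := w.IsChain (· ≠ ·)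

/-- The reduced form of `i :: w` for a reduced word `w`. -/
def step (i : Fin Δ) : List (Fin Δ) → List (Fin Δ)
  | [] => [i]
  | j :: w => if j = i then w else i :: j :: w

@[simp] lemma step_nil (i : Fin Δ) : step i [] = [i] := rfl

@[simp] lemma step_cons_self (i : Fin Δ) (w : List (Fin Δ)) : step i (i :: w) = w := by
  simp [step]

lemma step_cons_of_ne {i j : Fin Δ} (h : j ≠ i) (w : List (Fin Δ)) :
    step i (j :: w) = i :: j :: w := by
  simp [step, h]

lemma step_of_reduced_cons {i : Fin Δ} {w : List (Fin Δ)} (h : Reduced (i :: w)) :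
    step i w = i :: w := by
  cases w with
  | nil => rfl
  | cons j w =>
    exact step_cons_of_ne (List.isChain_cons_cons.1 h).1.symm w

lemma reduced_step {i : Fin Δ} {w : List (Fin Δ)} (h : Reduced w) : Reduced (step i w) := by
  cases w with
  | nil => simp [Reduced]
  | cons j w =>
    by_cases hj : j = i
    · subst hj; simpa using h.tail
    · rw [step_cons_of_ne hj]
      exact List.isChain_cons_cons.2 ⟨fun e => hj e.symm, h⟩

lemma step_step (i : Fin Δ) {w : List (Fin Δ)} (h : Reduced w) : step i (step i w) = w := by
  cases w with
  | nil => simp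
  | cons j w =>
    by_cases hj : j = i
    · subst hj; rw [step_cons_self, step_of_reduced_cons h]
    · rw [step_cons_of_ne hj, step_cons_self]

lemma length_step_le (i : Fin Δ) (w : List (Fin Δ)) : (step i w).length ≤ w.length + 1 := by
  cases w with
  | nil => simp
  | cons j w =>
    by_cases hj : j = i
    · subst hj; simp; lia
    · rw [step_cons_of_ne hj]; simp

/-- The labelling `x`, seen from the neighbour of the root behind the edge of colour `i`. -/
def reroot (i : Fin Δ) (x : List (Fin Δ) → V) : List (Fin Δ) → V := fun w => x (step i w)

/-- The labelling `x`, seen from the vertex `w`. -/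
def shift (w : List (Fin Δ)) (x : List (Fin Δ) → V) : List (Fin Δ) → V :=
  w.foldl (fun y i => reroot i y) x

@[simp] lemma shift_nil (x : List (Fin Δ) → V) : shift [] x = x := rfl

lemma shift_cons (i : Fin Δ) (w : List (Fin Δ)) (x : List (Fin Δ) → V) :
    shift (i :: w) x = shift w (reroot i x) := rfl

lemma shift_append_singleton (w : List (Fin Δ)) (i : Fin Δ) (x : List (Fin Δ) → V) :
    shift (w ++ [i]) x = reroot i (shift w x) := by
  simp [shift]

/-- Labels of vertices that are connected by an edge of colour `i` are related by `H i`. -/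
def IsLabelling (H : Fin Δ → V → V → Prop) (x : List (Fin Δ) → V) : Prop :=
  ∀ w i, Reduced (w ++ [i]) → H i (x w) (x (w ++ [i]))

/-- The labellings agree on the ball of radius `T` around the root. -/
def Agree (T : ℕ) (x y : List (Fin Δ) → V) : Prop :=
  ∀ w, Reduced w → w.length ≤ T → x w = y w

lemma Agree.refl (T : ℕ) (x : List (Fin Δ) → V) : Agree T x x := fun _ _ _ => rfl

lemma Agree.symm {T : ℕ} {x y : List (Fin Δ) → V} (h : Agree T x y) : Agree T y x :=
  fun w hw hl => (h w hw hl).symm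

lemma Agree.trans {T : ℕ} {x y z : List (Fin Δ) → V} (h : Agree T x y) (h' : Agree T y z) :
    Agree T x z :=
  fun w hw hl => (h w hw hl).trans (h' w hw hl)

lemma Agree.mono {T T' : ℕ} {x y : List (Fin Δ) → V} (h : Agree T x y) (hT : T' ≤ T) :
    Agree T' x y :=
  fun w hw hl => h w hw (hl.trans hT)

lemma Agree.reroot {T : ℕ} {x y : List (Fin Δ) → V} (h : Agree (T + 1) x y) (i : Fin Δ) :
    Agree T (reroot i x) (reroot i y) :=
  fun w hw hl => h _ (reduced_step hw) ((length_step_le i w).trans (by lia))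

/-- `step i` is an involution on reduced words only. Values at other words are meaningless, so
identities between labellings are stated through agreement rather than equality. -/
lemma agree_reroot_reroot (T : ℕ) (i : Fin Δ) (x : List (Fin Δ) → V) :
    Agree T (reroot i (reroot i x)) x := fun w hw _ => by
  simp only [RegTree.reroot, step_step i hw]

variable {H : Fin Δ → V → V → Prop}

lemma IsLabelling.reroot (hH : ∀ i a b, H i a b → H i b a) {x : List (Fin Δ) → V}
    (hx : IsLabelling H x) (i : Fin Δ) : IsLabelling H (reroot i x) := by
  intro w j hw
  simp only [RegTree.reroot]
  cases w with
  | nil =>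
    by_cases hj : j = i
    · subst hj
      simpa using hH _ _ _ (hx [] j (by simp [Reduced]))
    · simpa [step_cons_of_ne hj] using
        hx [i] j (by simpa [Reduced] using fun e => hj e.symm)
  | cons k w =>
    by_cases hk : k = i
    · subst hk
      simpa using hx w j hw.tail
    · have := hx (i :: k :: w) j (by
        simpa using List.isChain_cons_cons.2 ⟨fun e => hk e.symm, hw⟩)
      simpa [step_cons_of_ne hk] using this

lemma IsLabelling.shift (hH : ∀ i a b, H i a b → H i b a) {x : List (Fin Δ) → V}
    (hx : IsLabelling H x) (w : List (Fin Δ)) : IsLabelling H (shift w x) := by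
  induction w generalizing x with
  | nil => exact hx
  | cons i w ih => exact ih (hx.reroot hH i)

/-! ### Gluing labellings along edges and at nodes -/

/-- The labelling with label `a` at the root and the branch of `y i` behind the edge of colour `i`
at the root. -/
def glue (a : V) (y : Fin Δ → List (Fin Δ) → V) : List (Fin Δ) → V
  | [] => a
  | i :: w => y i (i :: w)

@[simp] lemma glue_nil (a : V) (y : Fin Δ → List (Fin Δ) → V) : glue a y [] = a := rfl

@[simp] lemma glue_cons (a : V) (y : Fin Δ → List (Fin Δ) → V) (i : Fin Δ) (w : List (Fin Δ)) :
    glue a y (i :: w) = y i (i :: w) := rfl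

lemma isLabelling_glue {a : V} {y : Fin Δ → List (Fin Δ) → V} (hy : ∀ i, IsLabelling H (y i))
    (ha : ∀ i, H i a (y i [i])) : IsLabelling H (glue a y) := by
  intro w j hw
  cases w with
  | nil => simpa using ha j
  | cons k w => simpa using hy k (k :: w) j hw

lemma isLabelling_glue_of_root {a : V} {y : Fin Δ → List (Fin Δ) → V}
    (hy : ∀ i, IsLabelling H (y i)) (ha : ∀ i, y i [] = a) : IsLabelling H (glue a y) :=
  isLabelling_glue hy fun i => by simpa [ha i] using hy i [] i (by simp [Reduced])

/-- The labellings agree on the union of the balls of radius `T` around the two endpoints of the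
edge of colour `i` at the root. -/
def EdgeAgree (i : Fin Δ) (T : ℕ) (x y : List (Fin Δ) → V) : Prop :=
  ∀ w, Reduced w → (w.length ≤ T ∨ (w.head? = some i ∧ w.length ≤ T + 1)) → x w = y w

lemma EdgeAgree.refl (i : Fin Δ) (T : ℕ) (x : List (Fin Δ) → V) : EdgeAgree i T x x :=
  fun _ _ _ => rfl

lemma EdgeAgree.symm {i : Fin Δ} {T : ℕ} {x y : List (Fin Δ) → V} (h : EdgeAgree i T x y) :
    EdgeAgree i T y x :=
  fun w hw hl => (h w hw hl).symm

lemma EdgeAgree.trans {i : Fin Δ} {T : ℕ} {x y z : List (Fin Δ) → V} (h : EdgeAgree i T x y)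
    (h' : EdgeAgree i T y z) : EdgeAgree i T x z :=
  fun w hw hl => (h w hw hl).trans (h' w hw hl)

lemma EdgeAgree.reroot {i : Fin Δ} {T : ℕ} {x y : List (Fin Δ) → V} (h : EdgeAgree i T x y) :
    EdgeAgree i T (reroot i x) (reroot i y) := by
  intro w hw hl
  refine h _ (reduced_step hw) ?_
  cases w with
  | nil => exact Or.inr (by simp)
  | cons j w =>
    by_cases hj : j = i
    · subst hj
      left
      simp at hl ⊢
      lia
    · right
      rw [step_cons_of_ne hj]
      simp [hj] at hl ⊢
      lia

/-- Extensions beyond the two ends of an edge can be combined. -/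
lemma exists_glue_edge (hH : ∀ i a b, H i a b → H i b a) {i : Fin Δ} {T : ℕ}
    {x y y' : List (Fin Δ) → V} (hy : IsLabelling H y) (hy' : IsLabelling H y')
    (hxy : EdgeAgree i T x y) (hxy' : EdgeAgree i T (RegTree.reroot i x) y') :
    ∃ z, IsLabelling H z ∧ Agree (T + 1) z y ∧ Agree (T + 1) (RegTree.reroot i z) y' := by
  have hroot : x [] = y [] := hxy [] (by simp [Reduced]) (by simp)
  have hroot' : RegTree.reroot i y' [] = y [] := by
    rw [← hroot]
    have := hxy' [i] (by simp [Reduced]) (by simp)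
    simpa [RegTree.reroot] using this.symm
  -- The part that one end sees beyond the common view of the edge lies on its own side of the edge.
  -- So the far side is taken from `y'` and the near side from `y`.
  refine ⟨glue (y []) (fun j => if j = i then RegTree.reroot i y' else y), ?_, ?_, ?_⟩
  · refine isLabelling_glue_of_root (fun j => ?_) fun j => ?_
    · split_ifs
      exacts [hy'.reroot hH i, hy]
    · split_ifs
      exacts [hroot', rfl]
  · intro w hw hl
    cases w with
    | nil => rfl
    | cons j w =>
      by_cases hj : j = i
      · subst hj
        have h1 := hxy' (step j (j :: w)) (reduced_step hw) (by simp at hl ⊢; lia)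
        have h2 := hxy (j :: w) hw (by simp at hl ⊢; lia)
        simp only [RegTree.reroot, step_step j hw] at h1
        simp [RegTree.reroot, ← h2, h1]
      · simp [hj]
  · intro w hw hl
    cases w with
    | nil => simp [RegTree.reroot]
    | cons j w =>
      by_cases hj : j = i
      · subst hj
        have h1 := hxy' (j :: w) hw (by simp at hl ⊢; lia)
        have h2 := hxy w hw.tail (by simp at hl ⊢; lia)
        simp only [RegTree.reroot, step_cons_self] at h1
        rw [← h1, h2]
        cases w with
        | nil => simp [RegTree.reroot]
        | cons k w =>
          have hk : k ≠ j := (List.isChain_cons_cons.1 hw).1.symm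
          simp [RegTree.reroot, hk]
      · simp [RegTree.reroot, step_cons_of_ne hj]

/-- Extensions beyond all edges at the root can be combined. -/
lemma exists_glue_node {T : ℕ} {x : List (Fin Δ) → V} {y : Fin Δ → List (Fin Δ) → V}
    (hy : ∀ i, IsLabelling H (y i)) (hxy : ∀ i, Agree T x (y i)) :
    ∃ z, IsLabelling H z ∧ ∀ i, EdgeAgree i T z (y i) := by
  have h0 : ∀ i, y i [] = x [] := fun i => (hxy i [] (by simp [Reduced]) (by simp)).symm
  refine ⟨glue (x []) y, isLabelling_glue_of_root hy h0, fun i w hw hl => ?_⟩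
  cases w with
  | nil => exact (h0 i).symm
  | cons j w =>
    by_cases hj : j = i
    · subst hj; rfl
    · have hl' : (j :: w).length ≤ T := by
        simpa [hj] using hl
      rw [glue_cons, ← hxy j _ hw hl', hxy i _ hw hl']

end RegTree

/-! ### Round elimination -/

namespace RegTree

/-- What a node outputs at one of its edges: the colours that it claims, the levels at which it can
use the edge as its pointer, and the levels at which it can leave the edge without pointer. -/
structure HalfLabel (K : Type) where
  S : K → Prop
  P : ℕ → Prop
  U : ℕ → Prop

namespace HalfLabel

variable {K : Type}

/-- The constraint for the two labels of an edge, where `lev` assigns levels to the colours. -/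
structure Compat (lev : K → ℕ) (L L' : HalfLabel K) : Prop where
  disjoint : ∀ x, L.S x → ¬ L'.S x
  pointer : ∀ i j, L.P i → ¬ L'.P j
  level : ∀ i j, L.P i → L'.U j → j < i
  level' : ∀ i j, L'.P i → L.U j → j < i
  color : ∀ i x, L.P i → L'.S x → lev x < i
  color' : ∀ i x, L'.P i → L.S x → lev x < i

lemma Compat.symm {lev : K → ℕ} {L L' : HalfLabel K} (h : Compat lev L L') : Compat lev L' L :=
  ⟨fun x h1 h2 => h.disjoint x h2 h1, fun i j h1 h2 => h.pointer j i h2 h1, h.level', h.level,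
    h.color', h.color⟩

/-- The constraint for the labels at the edges of a node. -/
def NodeOk {Δ : ℕ} (β : ℕ) (L : Fin Δ → HalfLabel K) : Prop :=
  (¬ ∃ f : K → Fin Δ, Function.Injective f ∧ ∀ x, ¬ (L (f x)).S x) ∨
    ∃ j ≤ β, ∃ p, (L p).P j ∧ ∀ p' ≠ p, (L p').U j

lemma NodeOk.mono {Δ β : ℕ} {L L' : Fin Δ → HalfLabel K} (h : NodeOk β L)
    (hS : ∀ p x, (L p).S x → (L' p).S x) (hP : ∀ p x, (L p).P x → (L' p).P x)
    (hU : ∀ p x, (L p).U x → (L' p).U x) : NodeOk β L' := by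
  rcases h with h | ⟨j, hj, p, hp, hp'⟩
  · exact Or.inl fun ⟨f, hf, hfx⟩ => h ⟨f, hf, fun x hx => hfx x (hS _ _ hx)⟩
  · exact Or.inr ⟨j, hj, p, hP _ _ hp, fun p' h' => hU _ _ (hp' p' h')⟩

/-- Labels that contain everything that is implied by the constraint for edges. -/
structure Closed (lev : K → ℕ) (L : HalfLabel K) : Prop where
  P_mono : ∀ i j, i ≤ j → L.P i → L.P j
  U_anti : ∀ i j, i ≤ j → L.U j → L.U i
  U_of_P : ∀ i j, L.P i → L.U j
  U_of_S : ∀ x, L.S x → L.U (lev x)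
  S_of_P : ∀ x j, j ≤ lev x → L.P j → L.S x

/-- The closure of the label `L` of an edge whose other label is `L'`. -/
def closure (lev : K → ℕ) (L L' : HalfLabel K) : HalfLabel K where
  S x := L.S x ∨ ∃ j ≤ lev x, L.P j
  P j := ∃ i ≤ j, L.P i
  U j := ∀ i, L'.P i → j < i

/-- A pointer on this side rules out any pointer on the other side, so the universal condition that
defines `U` becomes vacuous and every level is available. -/
lemma Compat.closed_closure {lev : K → ℕ} {L L' : HalfLabel K} (h : Compat lev L L') :
    Closed lev (closure lev L L') where
  P_mono := fun _ _ hij ⟨k, hk, hP⟩ => ⟨k, hk.trans hij, hP⟩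
  U_anti := fun _ _ hij hU k hk => hij.trans_lt (hU k hk)
  U_of_P := fun _ _ ⟨k, _, hP⟩ m hm => (h.pointer k m hP hm).elim
  U_of_S := by
    rintro x (hx | ⟨j, _, hP⟩) m hm
    · exact h.color' m x hm hx
    · exact (h.pointer j m hP hm).elim
  S_of_P := fun _ _ hj ⟨k, hk, hP⟩ => Or.inr ⟨k, hk.trans hj, hP⟩

lemma Compat.closure {lev : K → ℕ} {L L' : HalfLabel K} (h : Compat lev L L') :
    Compat lev (closure lev L L') (closure lev L' L) := by
  have key : ∀ {L L' : HalfLabel K}, Compat lev L L' →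
      (∀ x, (HalfLabel.closure lev L L').S x → ¬ (HalfLabel.closure lev L' L).S x) ∧
      (∀ i j, (HalfLabel.closure lev L L').P i → ¬ (HalfLabel.closure lev L' L).P j) ∧
      (∀ i j, (HalfLabel.closure lev L L').P i → (HalfLabel.closure lev L' L).U j → j < i) ∧
      (∀ i x, (HalfLabel.closure lev L L').P i → (HalfLabel.closure lev L' L).S x → lev x < i) := by
    intro L L' h
    refine ⟨?_, ?_, ?_, ?_⟩
    · rintro x (hx | ⟨j, hj, hP⟩) (hx' | ⟨j', hj', hP'⟩)
      · exact h.disjoint x hx hx'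
      · exact absurd (h.color' j' x hP' hx) (by lia)
      · exact absurd (h.color j x hP hx') (by lia)
      · exact h.pointer _ _ hP hP'
    · rintro i j ⟨k, _, hk⟩ ⟨m, _, hm⟩
      exact h.pointer k m hk hm
    · rintro i j ⟨k, hki, hk⟩ hU
      exact (hU k hk).trans_le hki
    · rintro i x ⟨k, hki, hk⟩ (hx | ⟨j, _, hP⟩)
      · exact (h.color k x hk hx).trans_le hki
      · exact (h.pointer k j hk hP).elim
  obtain ⟨h1, h2, h3, h4⟩ := key h
  obtain ⟨-, -, h3', h4'⟩ := key h.symm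
  exact ⟨h1, h2, h3, h3', h4, h4'⟩

/-- The colours after one step: a colour is promoted to some level that is at least its own. -/
abbrev Promoted (β : ℕ) (lev : K → ℕ) : Type := {q : K × Fin (β + 1) // lev q.1 ≤ q.2}

/-- The level of a promoted colour. -/
def promotedLevel (β : ℕ) (lev : K → ℕ) (q : Promoted β lev) : ℕ := q.1.2

/-- The condition under which a label supports a promoted colour. -/
def Supports {β : ℕ} {lev : K → ℕ} (L : HalfLabel K) (q : Promoted β lev) : Prop :=
  L.P q.1.2 ∨ (L.U q.1.2 ∧ L.S q.1.1)

/-- What all of the labels of a family have in common. -/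
def common (β : ℕ) (lev : K → ℕ) (M : Set (HalfLabel K)) : HalfLabel (Promoted β lev) where
  S q := ∀ L ∈ M, L.Supports q
  P j := ∀ L ∈ M, L.P j
  U j := ∀ L ∈ M, L.U j

/-- One compatible pair of members suffices, since the common label is weaker than each member. If
both ends supported the same promoted colour of level `j`, then either both would claim the
underlying colour, or a pointer at level `j` would face a label with `P j` or `U j`; all of these
are forbidden. -/
lemma Compat.common {β : ℕ} {lev : K → ℕ} {L L' : HalfLabel K} {M M' : Set (HalfLabel K)}
    (h : Compat lev L L') (hc : Closed lev L) (hc' : Closed lev L') (hL : L ∈ M) (hL' : L' ∈ M') :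
    Compat (promotedLevel β lev) (common β lev M) (common β lev M') := by
  have hSP : ∀ {L L' : HalfLabel K}, Compat lev L L' → Closed lev L' →
      ∀ i, ∀ q : Promoted β lev, L.P i → L'.Supports q → promotedLevel β lev q < i := by
    rintro L L' h hc i q hi (hq | ⟨hq, -⟩)
    · exact (h.pointer _ _ hi hq).elim
    · exact h.level _ _ hi hq
  refine ⟨fun q h1 h2 => ?_, fun i j h1 h2 => h.pointer i j (h1 _ hL) (h2 _ hL'),
    fun i j h1 h2 => h.level i j (h1 _ hL) (h2 _ hL'),
    fun i j h1 h2 => h.level' i j (h1 _ hL') (h2 _ hL),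
    fun i q h1 h2 => hSP h hc' i q (h1 _ hL) (h2 _ hL'),
    fun i q h1 h2 => hSP h.symm hc i q (h1 _ hL') (h2 _ hL)⟩
  have h1 := h1 _ hL
  have h2 := h2 _ hL'
  rcases h1 with hP | hS
  · exact lt_irrefl _ (hSP h hc' _ q hP h2)
  · rcases h2 with hP | hS'
    · exact lt_irrefl _ (hSP h.symm hc _ q hP (Or.inr hS))
    · exact h.disjoint _ hS.2 hS'.2

/-! ### The combinatorial core of round elimination -/

section node

variable {Δ β : ℕ} {lev : K → ℕ} {M : Fin Δ → Set (HalfLabel K)}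

/-- A selection of labels contradicts the node constraint if the colours have distinct ports at
which they are unclaimed and a threshold `m` kills all pointers: below `m` no port offers one, and
from `m` on some port refuses to be without one. The refusing port cannot carry the pointer itself,
because `P` implies `U` in a closed label. -/
lemma choice_false {m : ℕ} (hM : ∀ g : Fin Δ → HalfLabel K, (∀ p, g p ∈ M p) → NodeOk β g)
    (hcl : ∀ p, ∀ L ∈ M p, Closed lev L) {g : Fin Δ → HalfLabel K} (hg : ∀ p, g p ∈ M p)
    (hlow : ∀ p, ∀ j < m, ¬ (g p).P j) (hhigh : ∀ j, m ≤ j → j ≤ β → ∃ q, ¬ (g q).U j)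
    {f : K → Fin Δ} (hf : Function.Injective f) (hfS : ∀ x, ¬ (g (f x)).S x) : False := by
  rcases hM g hg with h | ⟨j, hj, p, hp, hp'⟩
  · exact h ⟨f, hf, hfS⟩
  · rcases lt_or_ge j m with hjm | hjm
    · exact hlow p j hjm hp
    · obtain ⟨q, hq⟩ := hhigh j hjm hj
      by_cases hqp : q = p
      · subst hqp
        exact hq ((hcl q _ (hg q)).U_of_P _ _ hp)
      · exact hq (hp' q hqp)

/-- A single blocking label `Z`, one without `U m`, can serve as the refusing port for all levels
from `m` on, as `U` is closed downwards. It also offers no pointer at all, so it may overwrite the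
label at `q` as long as it does not claim a colour assigned to `q`. -/
lemma choice_false' {m : ℕ} (hM : ∀ g : Fin Δ → HalfLabel K, (∀ p, g p ∈ M p) → NodeOk β g)
    (hcl : ∀ p, ∀ L ∈ M p, Closed lev L) (hlow : ∀ p, ∃ L ∈ M p, ∀ j < m, ¬ L.P j)
    {f : K → Fin Δ} (hf : Function.Injective f) {lam : K → HalfLabel K}
    (hlam : ∀ x, lam x ∈ M (f x)) (hlamS : ∀ x, ¬ (lam x).S x)
    (hlamP : ∀ x, ∀ j < m, ¬ (lam x).P j) {q : Fin Δ} {Z : HalfLabel K} (hZ : Z ∈ M q)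
    (hZU : ¬ Z.U m) (hqf : ∀ x, f x = q → ¬ Z.S x) : False := by
  classical
  choose N hN hNP using hlow
  set g₀ : Fin Δ → HalfLabel K := fun p => if h : ∃ x, f x = p then lam h.choose else N p
  have hg₀ : ∀ x, g₀ (f x) = lam x := by
    intro x
    have h : ∃ y, f y = f x := ⟨x, rfl⟩
    simp only [g₀, dif_pos h]
    rw [hf h.choose_spec]
  have hg₀M : ∀ p, g₀ p ∈ M p ∧ ∀ j < m, ¬ (g₀ p).P j := by
    intro p
    by_cases h : ∃ x, f x = p
    · obtain ⟨x, rfl⟩ := h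
      rw [hg₀]
      exact ⟨hlam x, hlamP x⟩
    · simp only [g₀, dif_neg h]
      exact ⟨hN p, hNP p⟩
  refine choice_false (m := m) hM hcl (g := Function.update g₀ q Z) ?_ ?_ ?_ hf ?_
  · intro p
    by_cases h : p = q
    · subst h; simpa using hZ
    · simpa [h] using (hg₀M p).1
  · intro p j hj
    by_cases h : p = q
    · subst h
      simpa using fun hP => hZU ((hcl _ _ hZ).U_of_P _ _ hP)
    · simpa [h] using (hg₀M p).2 j hj
  · intro j hj _
    exact ⟨q, by simpa using fun hU => hZU ((hcl _ _ hZ).U_anti _ _ hj hU)⟩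
  · intro x
    by_cases h : f x = q
    · simpa [h] using hqf x h
    · simpa [h, hg₀] using hlamS x

/-- The node constraint survives a step of round elimination. -/
lemma nodeOk_common (hM : ∀ g : Fin Δ → HalfLabel K, (∀ p, g p ∈ M p) → NodeOk β g)
    (hcl : ∀ p, ∀ L ∈ M p, Closed lev L) (hlev : ∀ x, lev x ≤ β)
    (hne : ∀ p, (M p).Nonempty) : NodeOk β fun p => common β lev (M p) := by
  classical
  by_contra hcon
  simp only [NodeOk, not_or, not_not] at hcon
  obtain ⟨⟨F, hF, hFS⟩, hptr⟩ := hcon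
  simp only [common, not_forall] at hFS
  choose lam hlam hlamS using hFS
  -- the port and the label for the promotion of a colour to a given level
  let pr : ∀ (x : K) (j : ℕ), lev x ≤ j → j ≤ β → Promoted β lev :=
    fun x j h1 h2 => ⟨(x, ⟨j, by lia⟩), h1⟩
  have hpr : ∀ x j h1 h2, ¬ (lam (pr x j h1 h2)).P j ∧
      ((lam (pr x j h1 h2)).U j → ¬ (lam (pr x j h1 h2)).S x) := fun x j h1 h2 => by
    have := hlamS (pr x j h1 h2)
    simp only [Supports, not_or, not_and] at this
    exact this
  have hprne : ∀ x y j j' h1 h2 h1' h2', F (pr x j h1 h2) = F (pr y j' h1' h2') → x = y ∧ j = j' := by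
    intro x y j j' h1 h2 h1' h2' h
    have := hF h
    simp only [pr, Subtype.mk.injEq, Prod.mk.injEq, Fin.mk.injEq] at this
    exact this
  -- the lowest level that some label excludes
  obtain ⟨m, hmβ, hmU, hm⟩ : ∃ m, m ≤ β + 1 ∧ (∀ j < m, ∀ p, ∀ L ∈ M p, L.U j) ∧
      (m ≤ β → ∃ q, ∃ Z ∈ M q, ¬ Z.U m) := by
    have hex : ∃ m, m = β + 1 ∨ ∃ q, ∃ Z ∈ M q, ¬ Z.U m := ⟨β + 1, Or.inl rfl⟩
    refine ⟨Nat.find hex, Nat.find_min' hex (Or.inl rfl), fun j hj p L hL => ?_, fun h => ?_⟩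
    · by_contra hU
      exact Nat.find_min hex hj (Or.inr ⟨p, L, hL, hU⟩)
    · rcases Nat.find_spec hex with h' | h'
      · lia
      · exact h'
  -- Level `m - 1` is free at all labels of all ports. If every label of some port had a pointer
  -- below `m`, then by monotonicity all would have one at `m - 1`, and the common labels would have
  -- a valid pointer there.
  have hlow : ∀ p, ∃ L ∈ M p, ∀ j < m, ¬ L.P j := by
    intro p
    rcases Nat.eq_zero_or_pos m with h0 | hpos
    · obtain ⟨L, hL⟩ := hne p
      exact ⟨L, hL, by lia⟩
    · by_contra hno
      push Not at hno
      refine hptr ⟨m - 1, by lia, p, fun L hL => ?_, fun p' _ L hL => hmU _ (by lia) _ _ hL⟩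
      obtain ⟨j, hj, hP⟩ := hno L hL
      exact (hcl p L hL).P_mono _ _ (by lia) hP
  -- With this promotion the unsupported label has no pointer below `m`. If it claimed `x`, then `U`
  -- would hold at level `jx x`, by `U_of_S` or by minimality of `m`, and the promoted colour would
  -- be supported; so it does not claim `x`.
  let jx : K → ℕ := fun x => max (lev x) (m - 1)
  have hj1 : ∀ x, lev x ≤ jx x := fun x => le_max_left _ _
  have hj2 : ∀ x, jx x ≤ β := fun x => max_le (hlev x) (by lia)
  let f : K → Fin Δ := fun x => F (pr x (jx x) (hj1 x) (hj2 x))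
  let l : K → HalfLabel K := fun x => lam (pr x (jx x) (hj1 x) (hj2 x))
  have hf : Function.Injective f := fun x y h =>
    (hprne x y _ _ (hj1 x) (hj2 x) (hj1 y) (hj2 y) h).1
  have hl : ∀ x, l x ∈ M (f x) := fun x => hlam _
  have hlP : ∀ x, ∀ j < m, ¬ (l x).P j := fun x j hj hP =>
    (hpr x _ (hj1 x) (hj2 x)).1 ((hcl _ _ (hl x)).P_mono _ _ (by simp only [jx]; lia) hP)
  have hlS : ∀ x, ¬ (l x).S x := by
    intro x hS
    refine (hpr x _ (hj1 x) (hj2 x)).2 ?_ hS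
    rcases le_or_gt m (lev x) with h | h
    · have : jx x = lev x := by simp only [jx]; lia
      have hU := (hcl _ _ (hl x)).U_of_S x hS
      rw [← this] at hU
      exact hU
    · exact hmU _ (by simp only [jx]; lia) _ _ (hl x)
  rcases Nat.lt_or_ge β m with hβm | hmβ'
  · choose N hN hNP using hlow
    let g : Fin Δ → HalfLabel K := fun p => if h : ∃ x, f x = p then l h.choose else N p
    have hgf : ∀ x, g (f x) = l x := by
      intro x
      have h : ∃ y, f y = f x := ⟨x, rfl⟩
      simp only [g, dif_pos h]
      rw [hf h.choose_spec]
    have hg : ∀ p, g p ∈ M p ∧ ∀ j < m, ¬ (g p).P j := by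
      intro p
      by_cases h : ∃ x, f x = p
      · obtain ⟨x, rfl⟩ := h
        rw [hgf]
        exact ⟨hl x, hlP x⟩
      · simp only [g, dif_neg h]
        exact ⟨hN p, hNP p⟩
    exact choice_false (m := m) hM hcl (fun p => (hg p).1) (fun p => (hg p).2)
      (fun j h1 h2 => by lia) hf fun x => by rw [hgf]; exact hlS x
  · obtain ⟨q, Z, hZ, hZU⟩ := hm hmβ'
    by_cases hq : ∀ x, f x = q → ¬ Z.S x
    · exact choice_false' hM hcl hlow hf hl hlS hlP hZ hZU hq
    · push Not at hq
      obtain ⟨x₀, hx₀, hZS⟩ := hq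
      have hlt : lev x₀ < m := by
        by_contra hge
        exact hZU ((hcl _ _ hZ).U_anti _ _ (by lia) ((hcl _ _ hZ).U_of_S _ hZS))
      have hjx₀ : jx x₀ = m - 1 := by simp only [jx]; lia
      -- The blocker `Z` claims the colour `x₀` that is assigned to its port, so `x₀` must move. Its
      -- promotion to level `m` provides a fresh port: if the label there has `U m`, it does not
      -- claim `x₀` and `x₀` moves to it; otherwise that label is itself a blocker, at a port to
      -- which no colour is assigned.
      set r := F (pr x₀ m hlt.le hmβ')
      have hr : ∀ x, f x ≠ r := by
        intro x h
        obtain ⟨rfl, h'⟩ := hprne x x₀ _ _ (hj1 x) (hj2 x) hlt.le hmβ' h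
        lia
      have hlr := hlam (pr x₀ m hlt.le hmβ')
      obtain ⟨hrP, hrU⟩ := hpr x₀ m hlt.le hmβ'
      by_cases hU : (lam (pr x₀ m hlt.le hmβ')).U m
      · have hq' : ∀ x, f x = q → x = x₀ := fun x hx => hf (hx.trans hx₀.symm)
        refine choice_false' (f := Function.update f x₀ r)
          (lam := Function.update l x₀ (lam (pr x₀ m hlt.le hmβ'))) hM hcl hlow ?_ ?_ ?_ ?_ hZ hZU ?_
        · intro x y hxy
          by_cases hx : x = x₀ <;> by_cases hy : y = x₀
          · rw [hx, hy]
          · subst hx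
            simp [hy] at hxy
            exact (hr y hxy.symm).elim
          · subst hy
            simp [hx] at hxy
            exact (hr x hxy).elim
          · simp [hx, hy] at hxy
            exact hf hxy
        · intro x
          by_cases hx : x = x₀
          · subst hx; simpa using hlr
          · simpa [hx] using hl x
        · intro x
          by_cases hx : x = x₀
          · subst hx; simpa using hrU hU
          · simpa [hx] using hlS x
        · intro x j hj
          by_cases hx : x = x₀
          · subst hx
            simpa using fun hP => hrP ((hcl _ _ hlr).P_mono _ _ hj.le hP)
          · simpa [hx] using hlP x j hj
        · intro x hx
          by_cases hx' : x = x₀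
          · subst hx'
            simp only [Function.update_self] at hx
            exact (hr x (hx₀.trans hx.symm)).elim
          · simp only [Function.update_of_ne hx'] at hx
            exact (hx' (hq' x hx)).elim
      · exact choice_false' hM hcl hlow hf hl hlS hlP hlr hU fun x hx => (hr x hx).elim

end node

end HalfLabel

/-! ### Eliminating one round on the infinite tree -/

open HalfLabel

variable {Δ : ℕ} {V K : Type}

/-- `F` solves, in `T` rounds on all labellings with `H`, the problem with colours `K` of levels
`lev`. -/
structure Solves (H : Fin Δ → V → V → Prop) (β : ℕ) (lev : K → ℕ) (T : ℕ)
    (F : (List (Fin Δ) → V) → Fin Δ → HalfLabel K) : Prop where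
  congr_of_agree : ∀ x y, IsLabelling H x → IsLabelling H y → Agree T x y → F x = F y
  node : ∀ x, IsLabelling H x → NodeOk β (F x)
  edge : ∀ x, IsLabelling H x → ∀ i, Compat lev (F x i) (F (reroot i x) i)

/-- A step of round elimination. -/
theorem Solves.exists_step {H : Fin Δ → V → V → Prop} (hH : ∀ i a b, H i a b → H i b a)
    {β T : ℕ} {lev : K → ℕ} (hlev : ∀ x, lev x ≤ β) {F : (List (Fin Δ) → V) → Fin Δ → HalfLabel K}
    (hF : Solves H β lev (T + 1) F) :
    ∃ F', Solves H β (promotedLevel β lev) T F' := by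
  -- First half of the step: the label depends only on what lies within `T` of either end of the
  -- edge, and collects everything that `F` might output there for some extension. The extensions at
  -- the two ends are independent, so any two collected outputs occur together and the edge
  -- constraint persists.
  let E : (List (Fin Δ) → V) → Fin Δ → HalfLabel K := fun x i =>
    { S := fun s => ∃ y, IsLabelling H y ∧ EdgeAgree i T x y ∧ (F y i).S s
      P := fun s => ∃ y, IsLabelling H y ∧ EdgeAgree i T x y ∧ (F y i).P s
      U := fun s => ∃ y, IsLabelling H y ∧ EdgeAgree i T x y ∧ (F y i).U s }
  have hEcongr : ∀ i x y, EdgeAgree i T x y → E x i = E y i := by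
    intro i x y h
    have key : ∀ z, EdgeAgree i T x z ↔ EdgeAgree i T y z :=
      fun z => ⟨fun h' => h.symm.trans h', fun h' => h.trans h'⟩
    simp only [E, key]
  have hE : ∀ x, IsLabelling H x → ∀ i, Compat lev (E x i) (E (reroot i x) i) := by
    intro x hx i
    have key : ∀ y y', IsLabelling H y → IsLabelling H y' → EdgeAgree i T x y →
        EdgeAgree i T (reroot i x) y' → Compat lev (F y i) (F y' i) := by
      intro y y' hy hy' h h'
      obtain ⟨z, hz, hzy, hzy'⟩ := exists_glue_edge hH hy hy' h h'
      rw [← hF.congr_of_agree _ _ hz hy hzy, ← hF.congr_of_agree _ _ (hz.reroot hH i) hy' hzy']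
      exact hF.edge z hz i
    refine ⟨?_, ?_, ?_, ?_, ?_, ?_⟩
    · rintro s ⟨y, hy, h, hs⟩ ⟨y', hy', h', hs'⟩
      exact (key _ _ hy hy' h h').disjoint _ hs hs'
    · rintro s s' ⟨y, hy, h, hs⟩ ⟨y', hy', h', hs'⟩
      exact (key _ _ hy hy' h h').pointer _ _ hs hs'
    · rintro s s' ⟨y, hy, h, hs⟩ ⟨y', hy', h', hs'⟩
      exact (key _ _ hy hy' h h').level _ _ hs hs'
    · rintro s s' ⟨y', hy', h', hs'⟩ ⟨y, hy, h, hs⟩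
      exact (key _ _ hy hy' h h').level' _ _ hs' hs
    · rintro s s' ⟨y, hy, h, hs⟩ ⟨y', hy', h', hs'⟩
      exact (key _ _ hy hy' h h').color _ _ hs hs'
    · rintro s s' ⟨y', hy', h', hs'⟩ ⟨y, hy, h, hs⟩
      exact (key _ _ hy hy' h h').color' _ _ hs' hs
  let B : (List (Fin Δ) → V) → Fin Δ → HalfLabel K := fun x i =>
    HalfLabel.closure lev (E x i) (E (reroot i x) i)
  have hBcongr : ∀ i x y, EdgeAgree i T x y → B x i = B y i := by
    intro i x y h
    simp only [B, hEcongr i x y h, hEcongr i _ _ h.reroot]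
  have hBcl : ∀ x, IsLabelling H x → ∀ i, Closed lev (B x i) :=
    fun x hx i => (hE x hx i).closed_closure
  have hErr : ∀ x i, E (reroot i (reroot i x)) i = E x i := fun x i =>
    hEcongr _ _ _ fun w hw _ => by simp only [reroot, step_step i hw]
  have hB : ∀ x, IsLabelling H x → ∀ i, Compat lev (B x i) (B (reroot i x) i) := by
    intro x hx i
    have := (hE x hx i).closure
    simp only [B, hErr]
    exact this
  have hBnode : ∀ x, IsLabelling H x → NodeOk β (B x) := by
    intro x hx
    refine (hF.node x hx).mono (fun p s h => Or.inl ⟨x, hx, EdgeAgree.refl _ _ _, h⟩)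
      (fun p s h => ⟨s, le_rfl, x, hx, EdgeAgree.refl _ _ _, h⟩) fun p s h i hi => ?_
    exact (hE x hx p).level' _ _ hi ⟨x, hx, EdgeAgree.refl _ _ _, h⟩
  -- Second half: the ball of radius `T` leaves a set of possible labels at each port, and the new
  -- output keeps what they have in common. Extensions behind different ports are independent, so
  -- every selection from these sets is realised by one labelling and satisfies the node constraint.
  let M : (List (Fin Δ) → V) → Fin Δ → Set (HalfLabel K) := fun x i =>
    {L | ∃ y, IsLabelling H y ∧ Agree T x y ∧ L = B y i}
  refine ⟨fun x i => common β lev (M x i), ?_, ?_, ?_⟩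
  · intro x y _ _ h
    have key : ∀ z, Agree T x z ↔ Agree T y z :=
      fun z => ⟨fun h' => h.symm.trans h', fun h' => h.trans h'⟩
    simp only [M, key]
  · intro x hx
    refine nodeOk_common (M := M x) ?_ ?_ hlev fun p => ⟨_, x, hx, Agree.refl _ _, rfl⟩
    · intro g hg
      choose y hy hxy hgy using hg
      obtain ⟨z, hz, hzy⟩ := exists_glue_node hy hxy
      have : g = B z := by
        funext i
        rw [hgy i, hBcongr i _ _ (hzy i)]
      rw [this]
      exact hBnode z hz
    · rintro p L ⟨y, hy, -, rfl⟩
      exact hBcl y hy p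
  · intro x hx i
    exact (hB x hx i).common (hBcl x hx i) (hBcl _ (hx.reroot hH i) i)
      ⟨x, hx, Agree.refl _ _, rfl⟩ ⟨_, hx.reroot hH i, Agree.refl _ _, rfl⟩

end RegTree

/-! ### Zero rounds, and counting the colours -/

namespace RegTree

open HalfLabel

variable {Δ : ℕ} {V K : Type}

/-- Every vertex of the graph `H` is the root of a labelling. -/
lemma exists_isLabelling {H : Fin Δ → V → V → Prop} {U : Set V}
    (hext : ∀ a ∈ U, ∀ i, ∃ b ∈ U, H i a b) {a : V} (ha : a ∈ U) :
    ∃ x, IsLabelling H x ∧ x [] = a := by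
  choose! next hnext hH using hext
  let x : List (Fin Δ) → V := fun w => w.foldl (fun b i => next b i) a
  have hx : ∀ w, x w ∈ U := by
    intro w
    induction w using List.reverseRecOn with
    | nil => exact ha
    | append_singleton w i ih => simpa [x] using hnext _ ih i
  exact ⟨x, fun w i _ => by simpa [x] using hH _ (hx w) i, rfl⟩

/-- The problem cannot be solved in `0` rounds if there are few colours. -/
lemma not_solves_zero [NeZero Δ] [Fintype K] {H : Fin Δ → V → V → Prop} {U : Set V}
    (hext : ∀ a ∈ U, ∀ i, ∃ b ∈ U, H i a b)
    (hpig : ∀ φ : V → Fin Δ × Option (Fin Δ),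
      ∃ a ∈ U, ∃ b ∈ U, H (φ a).1 a b ∧ φ a = φ b)
    (hH : ∀ i a b, H i a b → H i b a) {β : ℕ} {lev : K → ℕ}
    (hK : Fintype.card K ≤ Δ) {F : (List (Fin Δ) → V) → Fin Δ → HalfLabel K} :
    ¬ Solves H β lev 0 F := by
  classical
  intro hF
  obtain ⟨emb⟩ : Nonempty (K ↪ Fin Δ) := Function.Embedding.nonempty_of_card_le (by simpa using hK)
  have hx : ∀ a, ∃ x : List (Fin Δ) → V, a ∈ U → IsLabelling H x ∧ x [] = a := by
    intro a
    by_cases ha : a ∈ U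
    · obtain ⟨x, hx⟩ := exists_isLabelling hext ha
      exact ⟨x, fun _ => hx⟩
    · exact ⟨fun _ => a, fun h => (ha h).elim⟩
  choose x hx using hx
  have hφ : ∀ a, ∃ q : Fin Δ × Option (Fin Δ), a ∈ U →
      (∃ s, q.2 = some (emb s) ∧ (F (x a) q.1).S s) ∨ (q.2 = none ∧ ∃ j, (F (x a) q.1).P j) := by
    intro a
    by_cases ha : a ∈ U
    · rcases hF.node _ (hx a ha).1 with h | ⟨j, -, p, hp, -⟩
      · push Not at h
        obtain ⟨s, hs⟩ := h emb emb.injective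
        exact ⟨(emb s, some (emb s)), fun _ => Or.inl ⟨s, rfl, hs⟩⟩
      · exact ⟨(p, none), fun _ => Or.inr ⟨rfl, j, hp⟩⟩
    · exact ⟨(0, none), fun h => (ha h).elim⟩
  choose φ hφ using hφ
  obtain ⟨a, ha, b, hb, hab, hφab⟩ := hpig φ
  set i := (φ a).1 with hi
  obtain ⟨hxa, hxa0⟩ := hx a ha
  obtain ⟨hxb, hxb0⟩ := hx b hb
  let z := glue a (fun j => if j = i then reroot i (x b) else x a)
  have hz : IsLabelling H z := by
    refine isLabelling_glue (fun j => ?_) fun j => ?_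
    · split_ifs
      exacts [hxb.reroot hH i, hxa]
    · split_ifs with h
      · subst h
        simpa [reroot, hxb0] using hab
      · simpa [hxa0] using hxa [] j (by simp [Reduced])
  have h1 : F z = F (x a) := hF.congr_of_agree _ _ hz hxa fun w _ hw => by
    obtain rfl : w = [] := by simpa using hw
    exact hxa0.symm
  have h2 : F (reroot i z) = F (x b) :=
    hF.congr_of_agree _ _ (hz.reroot hH i) hxb fun w _ hw => by
      obtain rfl : w = [] := by simpa using hw
      simp [reroot, z]
  have hc := hF.edge z hz i
  rw [h1, h2] at hc
  have hφb := hφ b hb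
  rw [← hφab] at hφb
  rcases hφ a ha with ⟨s, hs, hS⟩ | ⟨hn, j, hj⟩ <;> rcases hφb with ⟨s', hs', hS'⟩ | ⟨hn', j', hj'⟩
  · rw [hs] at hs'
    obtain rfl : s = s' := emb.injective (Option.some_injective _ hs')
    exact hc.disjoint s hS hS'
  · simp [hs] at hn'
  · simp [hn] at hs'
  · exact hc.pointer _ _ hj hj'

lemma sum_range_choose_add (s j : ℕ) :
    ∑ i ∈ Finset.range (j + 1), (s + i).choose i = (s + 1 + j).choose j := by
  induction j with
  | zero => simp
  | succ j ih =>
    rw [Finset.sum_range_succ, ih, show s + 1 + (j + 1) = (s + 1 + j) + 1 by ring,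
      Nat.choose_succ_succ, show s + (j + 1) = s + 1 + j by ring]

/-- The promoted colours of level exactly `i` are the colours of level at most `i`. Summing over `i
≤ j` turns one binomial coefficient into the next, by the hockey-stick identity. -/
lemma card_promoted_le [Finite K] {β : ℕ} {lev : K → ℕ} {a s : ℕ}
    (h : ∀ j ≤ β, Nat.card {x // lev x ≤ j} ≤ a * (s + j).choose j) :
    ∀ j ≤ β, Nat.card {q : Promoted β lev // promotedLevel β lev q ≤ j} ≤
      a * (s + 1 + j).choose j := by
  intro j hj
  classical
  have := Fintype.ofFinite K
  let g : {q : Promoted β lev // promotedLevel β lev q ≤ j} →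
      Σ i : Fin (j + 1), {x // lev x ≤ (i : ℕ)} :=
    fun q => ⟨⟨promotedLevel β lev q.1, by have := q.2; lia⟩, ⟨q.1.1.1, q.1.2⟩⟩
  have hg : Function.Injective g := by
    rintro ⟨⟨⟨x, i⟩, h1⟩, h2⟩ ⟨⟨⟨x', i'⟩, h1'⟩, h2'⟩ hq
    simp only [g, Sigma.mk.injEq, promotedLevel] at hq
    obtain ⟨hi, hx⟩ := hq
    have hi' := congrArg Fin.val hi
    obtain rfl : i = i' := Fin.ext hi'
    simpa using hx
  calc _ ≤ Nat.card (Σ i : Fin (j + 1), {x // lev x ≤ (i : ℕ)}) :=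
        Nat.card_le_card_of_injective g hg
    _ = ∑ i : Fin (j + 1), Nat.card {x // lev x ≤ (i : ℕ)} := Nat.card_sigma
    _ = ∑ i ∈ Finset.range (j + 1), Nat.card {x // lev x ≤ i} :=
        Fin.sum_univ_eq_sum_range (fun i => Nat.card {x // lev x ≤ i}) _
    _ ≤ ∑ i ∈ Finset.range (j + 1), a * (s + i).choose i :=
        Finset.sum_le_sum fun i hi => h i (by simp at hi; lia)
    _ = _ := by rw [← Finset.mul_sum, sum_range_choose_add]

/-- The lower bound for the problem with colours and pointers. -/
theorem not_solves [NeZero Δ] {H : Fin Δ → V → V → Prop} {U : Set V}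
    (hext : ∀ a ∈ U, ∀ i, ∃ b ∈ U, H i a b)
    (hpig : ∀ φ : V → Fin Δ × Option (Fin Δ),
      ∃ a ∈ U, ∃ b ∈ U, H (φ a).1 a b ∧ φ a = φ b)
    (hH : ∀ i a b, H i a b → H i b a) {β a : ℕ} (T s : ℕ) [Finite K] {lev : K → ℕ}
    (hlev : ∀ x, lev x ≤ β) (hK : ∀ j ≤ β, Nat.card {x // lev x ≤ j} ≤ a * (s + j).choose j)
    (hΔ : a * (s + T + β).choose β ≤ Δ) (F : (List (Fin Δ) → V) → Fin Δ → HalfLabel K) :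
    ¬ Solves H β lev T F := by
  induction T generalizing K s with
  | zero =>
    have := Fintype.ofFinite K
    refine not_solves_zero hext hpig hH ?_
    have h := hK β le_rfl
    rw [← Nat.card_eq_fintype_card, ← Nat.card_congr (Equiv.subtypeUnivEquiv hlev)]
    exact h.trans hΔ
  | succ T ih =>
    intro hF
    obtain ⟨F', hF'⟩ := hF.exists_step hH hlev
    refine ih (s + 1) (fun q => ?_) (card_promoted_le hK) ?_ F' hF'
    · exact Nat.lt_succ_iff.1 q.1.2.2
    · rwa [show s + 1 + T + β = s + (T + 1) + β by ring]

/-! ### Ruling sets on the infinite tree -/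

/-- There is a vertex with property `col` at distance at most `k` from the root. -/
def Near (col : (List (Fin Δ) → V) → Prop) : ℕ → (List (Fin Δ) → V) → Prop
  | 0, x => col x
  | k + 1, x => Near col k x ∨ ∃ i, Near col k (reroot i x)

lemma Near.mono {col : (List (Fin Δ) → V) → Prop} {k l : ℕ} (h : k ≤ l)
    {x : List (Fin Δ) → V} (hx : Near col k x) : Near col l x := by
  induction h with
  | refl => exact hx
  | step _ ih => exact Or.inl ih

lemma near_congr {H : Fin Δ → V → V → Prop} (hH : ∀ i a b, H i a b → H i b a)
    {col : (List (Fin Δ) → V) → Prop} {T : ℕ}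
    (hcol : ∀ x y, IsLabelling H x → IsLabelling H y → Agree T x y → (col x ↔ col y)) (k : ℕ)
    {x y : List (Fin Δ) → V} (hx : IsLabelling H x) (hy : IsLabelling H y)
    (hxy : Agree (T + k) x y) : Near col k x ↔ Near col k y := by
  induction k generalizing x y with
  | zero => exact hcol x y hx hy hxy
  | succ k ih =>
    exact or_congr (ih hx hy (hxy.mono (by lia))) (exists_congr fun i =>
      ih (hx.reroot hH i) (hy.reroot hH i) (hxy.reroot i))

/-- Ruling sets cannot be computed in few rounds on the infinite labelled tree. -/
theorem not_rulingSet [NeZero Δ] {H : Fin Δ → V → V → Prop} {U : Set V}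
    (hext : ∀ a ∈ U, ∀ i, ∃ b ∈ U, H i a b)
    (hpig : ∀ φ : V → Fin Δ × Option (Fin Δ),
      ∃ a ∈ U, ∃ b ∈ U, H (φ a).1 a b ∧ φ a = φ b)
    (hH : ∀ i a b, H i a b → H i b a) {α c β T : ℕ}
    (hΔ : c * (α + 1) * (T + β + 1 + β).choose β ≤ Δ)
    {col : (List (Fin Δ) → V) → Option (Fin c)} {out : (List (Fin Δ) → V) → Fin Δ → Prop}
    (hcol : ∀ x y, IsLabelling H x → IsLabelling H y → Agree T x y → col x = col y)
    (hout : ∀ x y, IsLabelling H x → IsLabelling H y → Agree T x y → out x = out y)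
    (horient : ∀ x, IsLabelling H x → ∀ i, col x ≠ none → col (reroot i x) ≠ none →
      out x i ∨ out (reroot i x) i)
    (hdef : ∀ x, IsLabelling H x → ∀ a, col x = some a →
      {i | out x i ∧ col (reroot i x) = some a}.encard ≤ α)
    (hdom : ∀ x, IsLabelling H x → Near (fun y => col y ≠ none) β x) : False := by
  classical
  set D : ℕ → (List (Fin Δ) → V) → Prop := Near (fun y => col y ≠ none)
  have hD : ∀ k x y, IsLabelling H x → IsLabelling H y → Agree (T + k) x y → (D k x ↔ D k y) :=
    fun k x y hx hy h => near_congr hH (fun x y hx hy h => by rw [hcol x y hx hy h]) k hx hy h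
  have hrr : ∀ x i, IsLabelling H x → col (reroot i (reroot i x)) = col x := fun x i hx =>
    hcol _ _ ((hx.reroot hH i).reroot hH i) hx (agree_reroot_reroot _ _ _)
  have hDrr : ∀ k x i, IsLabelling H x → (D k (reroot i (reroot i x)) ↔ D k x) := fun k x i hx =>
    hD k _ _ ((hx.reroot hH i).reroot hH i) hx (agree_reroot_reroot _ _ _)
  -- With `d` the distance to the ruling set, `P j` says that the neighbour has distance less than
  -- `j`, less than `β` and less than `d`, and `U j` says that `d` is at least `min j β`. The
  -- cut-off at `β` keeps the required radius bounded by `T + β + 1`.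
  let F : (List (Fin Δ) → V) → Fin Δ → HalfLabel (Fin c × Fin (α + 1)) := fun x i =>
    { S := fun s => col x = some s.1 ∧ ¬ (out x i ∧ col (reroot i x) = some s.1)
      P := fun j => ∃ k < j, k < β ∧ ¬ D k x ∧ D k (reroot i x)
      U := fun j => ∀ k < j, k < β → ¬ D k x }
  have hPU : ∀ x i j j', (∃ k < j, k < β ∧ ¬ D k x ∧ D k (reroot i x)) →
      (∀ k < j', k < β → ¬ D k (reroot i x)) → j' < j := by
    rintro x i j j' ⟨k, hk, hkβ, -, h⟩ h'
    by_contra hj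
    exact h' k (by lia) hkβ h
  refine not_solves (a := c * (α + 1)) hext hpig hH (T + β + 1) 0 (lev := fun _ => 0) (by simp)
    ?_ (by simpa using hΔ) F ⟨?_, ?_, ?_⟩
  · intro j _
    calc Nat.card {x : Fin c × Fin (α + 1) // 0 ≤ j} ≤ Nat.card (Fin c × Fin (α + 1)) :=
          Finite.card_subtype_le _
      _ = _ := by simp
  · intro x y hx hy h
    have e1 := hcol x y hx hy (h.mono (by lia))
    have e2 := hout x y hx hy (h.mono (by lia))
    have e3 : ∀ i, col (reroot i x) = col (reroot i y) := fun i =>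
      hcol _ _ (hx.reroot hH i) (hy.reroot hH i) ((h.reroot i).mono (by lia))
    have e4 : ∀ k < β, (D k x ↔ D k y) := fun k hk => hD k x y hx hy (h.mono (by lia))
    have e5 : ∀ i, ∀ k < β, (D k (reroot i x) ↔ D k (reroot i y)) := fun i k hk =>
      hD k _ _ (hx.reroot hH i) (hy.reroot hH i) ((h.reroot i).mono (by lia))
    funext i
    simp only [F, HalfLabel.mk.injEq]
    refine ⟨by simp only [e1, e2, e3], ?_, ?_⟩
    · funext j
      refine propext (exists_congr fun k => and_congr_right fun _ => and_congr_right fun hk => ?_)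
      rw [e4 k hk, e5 i k hk]
    · funext j
      refine propext (forall_congr' fun k => imp_congr_right fun _ => imp_congr_right fun hk => ?_)
      rw [e4 k hk]
  · intro x hx
    by_cases hc : col x = none
    · right
      have hex : ∃ k, D k x := ⟨β, hdom x hx⟩
      set d := Nat.find hex with hd
      have hdβ : d ≤ β := Nat.find_min' hex (hdom x hx)
      have hdspec : D d x := Nat.find_spec hex
      have hdmin : ∀ k < d, ¬ D k x := fun k hk => Nat.find_min hex hk
      rcases hd' : d with _ | k
      · rw [hd'] at hdspec
        exact (hdspec hc).elim
      · rw [hd'] at hdspec hdβ hdmin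
        rcases hdspec with h | ⟨i, hi⟩
        · exact (hdmin k (by lia) h).elim
        · exact ⟨k + 1, hdβ, i, ⟨k, by lia, by lia, hdmin k (by lia), hi⟩,
            fun p _ l hl _ => hdmin l hl⟩
    · left
      obtain ⟨a, ha⟩ := Option.ne_none_iff_exists'.1 hc
      rintro ⟨f, hf, hfS⟩
      have hsub : ∀ s : Fin (α + 1), f (a, s) ∈ {i | out x i ∧ col (reroot i x) = some a} := by
        intro s
        have := hfS (a, s)
        simp only [F, ha, true_and, not_not] at this
        exact this
      have hcard : ((α + 1 : ℕ) : ℕ∞) ≤ {i | out x i ∧ col (reroot i x) = some a}.encard := by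
        calc ((α + 1 : ℕ) : ℕ∞) = (Set.range fun s : Fin (α + 1) => f (a, s)).encard := by
              rw [← Set.image_univ, Function.Injective.encard_image]
              · simp
              · intro s s' h
                simpa using hf h
          _ ≤ _ := Set.encard_le_encard (by rintro _ ⟨s, rfl⟩; exact hsub s)
      have := hcard.trans (hdef x hx a ha)
      norm_cast at this
      lia
  · intro x hx i
    have hx' := hx.reroot hH i
    refine ⟨?_, ?_, ?_, ?_, ?_, ?_⟩
    · rintro s ⟨h1, h2⟩ ⟨h3, h4⟩
      rw [hrr x i hx] at h4
      rcases horient x hx i (by simp [h1]) (by simp [h3]) with h | h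
      · exact h2 ⟨h, h3⟩
      · exact h4 ⟨h, h1⟩
    -- Two opposite pointers would make each end strictly closer to the ruling set than the other.
    · rintro j j' ⟨k, -, -, h1, h2⟩ ⟨k', -, -, h1', h2'⟩
      have h2'' := (hDrr k' x i hx).1 h2'
      rcases le_total k k' with h | h
      · exact h1' (h2.mono h)
      · exact h1 (h2''.mono h)
    · exact fun j j' => hPU x i j j'
    · intro j j' h1 h2
      exact hPU _ i j j' h1 fun k hk hkβ => by
        rw [hDrr k x i hx]
        exact h2 k hk hkβ
    · rintro j s ⟨k, hk, -⟩ -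
      lia
    · rintro j s ⟨k, hk, -⟩ -
      lia

end RegTree

/-! ### Edge-coloured graphs without short cycles and without large independent sets -/

namespace RegTree

/-- No closed walk of length at most `g` on distinct vertices has distinct consecutive colours. -/
def NoShortCycle {Δ : ℕ} {V : Type} (H : Fin Δ → V → V → Prop) (g : ℕ) : Prop :=
  ∀ L, 1 ≤ L → L ≤ g → ∀ (v : ℕ → V) (c : ℕ → Fin Δ), Set.InjOn v (Set.Iio L) → v L = v 0 →
    (∀ k < L, H (c k) (v k) (v (k + 1))) → (∀ k, k + 1 < L → c k ≠ c (k + 1)) → False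

lemma card_filter_forall_mem {ι : Type} [Fintype ι] [DecidableEq ι] {P : ℕ} (C : Finset ι)
    (B : Finset (Fin P)) :
    (Finset.univ.filter fun F : ι → Fin P => ∀ t ∈ C, F t ∈ B).card * P ^ C.card =
      B.card ^ C.card * P ^ Fintype.card ι := by
  have h : (Finset.univ.filter fun F : ι → Fin P => ∀ t ∈ C, F t ∈ B) =
      Fintype.piFinset fun t => if t ∈ C then B else Finset.univ := by
    ext F
    simp only [Finset.mem_filter, Finset.mem_univ, true_and, Fintype.mem_piFinset]
    refine forall_congr' fun t => ?_
    split_ifs with ht <;> simp [ht]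
  have h2 : ∀ t, (if t ∈ C then B else Finset.univ : Finset (Fin P)).card =
      if t ∈ C then B.card else P := fun t => by split_ifs <;> simp
  rw [h, Fintype.card_piFinset]
  simp only [h2]
  rw [Finset.prod_ite]
  simp only [Finset.prod_const]
  have h3 : (Finset.univ.filter fun t => t ∈ C) = C := by ext; simp
  have h4 : (Finset.univ.filter fun t => t ∉ C) = Cᶜ := by ext; simp
  rw [h3, h4, mul_assoc, ← pow_add, Finset.card_compl, Nat.sub_add_cancel C.card_le_univ]

/-! ### Random edge-coloured graphs, by counting -/

section random

variable {Δ M P : ℕ} [NeZero P]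

/-- The edges of colour `i` in the random edge-coloured graph. -/
def randomAdj (F : Fin Δ × Sym2 (Fin M) → Fin P) (i : Fin Δ) (a b : Fin M) : Prop :=
  a ≠ b ∧ F (i, s(a, b)) = 0

lemma randomAdj.symm {F : Fin Δ × Sym2 (Fin M) → Fin P} {i : Fin Δ} {a b : Fin M}
    (h : randomAdj F i a b) : randomAdj F i b a :=
  ⟨h.1.symm, by rw [Sym2.eq_swap]; exact h.2⟩

/-- Bernoulli's inequality for `(1 + 1/Q)^n`, cleared of denominators. -/
lemma pow_mul_add_le (Q n : ℕ) : Q ^ n * (Q + n) ≤ Q * (Q + 1) ^ n := by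
  induction n with
  | zero => simp
  | succ n ih =>
    calc Q ^ (n + 1) * (Q + (n + 1)) = Q * (Q ^ n * (Q + n)) + Q * Q ^ n := by ring
      _ ≤ Q * (Q * (Q + 1) ^ n) + Q * (Q + 1) ^ n := by gcongr; lia
      _ = Q * (Q + 1) ^ (n + 1) := by ring

lemma two_mul_pred_pow_le (P : ℕ) (hP : 1 ≤ P) : 2 * (P - 1) ^ P ≤ P ^ P := by
  obtain ⟨Q, rfl⟩ : ∃ Q, P = Q + 1 := ⟨P - 1, by lia⟩
  rcases Nat.eq_zero_or_pos Q with rfl | hQ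
  · simp
  · simp only [Nat.add_sub_cancel]
    refine Nat.le_of_mul_le_mul_left ?_ hQ
    calc Q * (2 * Q ^ (Q + 1)) = Q ^ (Q + 1) * (Q + Q) := by ring
      _ ≤ Q ^ (Q + 1) * (Q + (Q + 1)) := by gcongr; lia
      _ ≤ _ := pow_mul_add_le Q (Q + 1)

-- A fixed set of size `s` misses a fixed colour with probability `(1 - 1/P)^(s.choose 2)`, which is
-- at most `4^(-M)` because `(1 - 1/P)^P ≤ 1/2`. The union bound over `Δ` colours and `2^M` sets
-- leaves `Δ / 2^M ≤ 1/2`.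
open Classical in
lemma card_independent_le {s : ℕ} (hM : 2 * Δ ≤ 2 ^ M) (hs : 2 * M * P ≤ s.choose 2) :
    2 * (Finset.univ.filter fun F : Fin Δ × Sym2 (Fin M) → Fin P =>
      ∃ i, ∃ A : Finset (Fin M), A.card = s ∧ ∀ a ∈ A, ∀ b ∈ A, ¬ randomAdj F i a b).card ≤
      P ^ Fintype.card (Fin Δ × Sym2 (Fin M)) := by
  set N := Fintype.card (Fin Δ × Sym2 (Fin M))
  have hP : 1 ≤ P := NeZero.one_le
  have hone : ∀ (i : Fin Δ) (A : Finset (Fin M)),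
      (Finset.univ.filter fun F : Fin Δ × Sym2 (Fin M) → Fin P =>
        A.card = s ∧ ∀ a ∈ A, ∀ b ∈ A, ¬ randomAdj F i a b).card * 4 ^ M ≤ P ^ N := by
    intro i A
    by_cases hA : A.card = s
    · let C : Finset (Fin Δ × Sym2 (Fin M)) := {i} ×ˢ A.offDiag.image (fun p => s(p.1, p.2))
      have hC : C.card = s.choose 2 := by
        simp only [C, Finset.card_product, Finset.card_singleton, one_mul]
        rw [← hA]
        exact Sym2.card_image_offDiag A
      have hsub : (Finset.univ.filter fun F : Fin Δ × Sym2 (Fin M) → Fin P =>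
          A.card = s ∧ ∀ a ∈ A, ∀ b ∈ A, ¬ randomAdj F i a b) ⊆
          (Finset.univ.filter fun F : Fin Δ × Sym2 (Fin M) → Fin P =>
            ∀ t ∈ C, F t ∈ (Finset.univ.erase 0 : Finset (Fin P))) := by
        intro F hF
        simp only [Finset.mem_filter, Finset.mem_univ, true_and] at hF ⊢
        rintro ⟨i', e⟩ ht
        simp only [C, Finset.mem_product, Finset.mem_singleton, Finset.mem_image,
          Finset.mem_offDiag] at ht
        obtain ⟨rfl, ⟨a, b⟩, ⟨ha, hb, hab⟩, rfl⟩ := ht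
        simp only [Finset.mem_erase, Finset.mem_univ, and_true]
        exact fun h0 => hF.2 a ha b hb ⟨hab, h0⟩
      have hcard := card_filter_forall_mem C (Finset.univ.erase 0 : Finset (Fin P))
      rw [Finset.card_erase_of_mem (Finset.mem_univ _), Finset.card_univ, Fintype.card_fin, hC]
        at hcard
      set m := s.choose 2
      have hpow : 4 ^ M * (P - 1) ^ m ≤ P ^ m := by
        obtain ⟨r, hr⟩ := Nat.exists_eq_add_of_le hs
        calc 4 ^ M * (P - 1) ^ m = (2 * (P - 1) ^ P) ^ (2 * M) * (P - 1) ^ r := by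
              rw [hr, mul_pow, pow_add, ← pow_mul, mul_comm P, pow_mul 2 2 M, ← mul_assoc]
              norm_num
          _ ≤ (P ^ P) ^ (2 * M) * P ^ r := by
              gcongr
              · exact two_mul_pred_pow_le P hP
              · lia
          _ = P ^ m := by rw [hr, pow_add, ← pow_mul, mul_comm P]
      have hPm : 0 < P ^ m := by positivity
      refine (Nat.mul_le_mul_right _ (Finset.card_le_card hsub)).trans ?_
      refine Nat.le_of_mul_le_mul_right ?_ hPm
      calc _ = (Finset.univ.filter fun F : Fin Δ × Sym2 (Fin M) → Fin P =>
            ∀ t ∈ C, F t ∈ (Finset.univ.erase 0 : Finset (Fin P))).card * P ^ m * 4 ^ M := by ring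
        _ = 4 ^ M * (P - 1) ^ m * P ^ N := by rw [hcard]; ring
        _ ≤ P ^ m * P ^ N := by gcongr
        _ = _ := by ring
    · simp [hA]
  have hbig : (Finset.univ.filter fun F : Fin Δ × Sym2 (Fin M) → Fin P =>
      ∃ i, ∃ A : Finset (Fin M), A.card = s ∧ ∀ a ∈ A, ∀ b ∈ A, ¬ randomAdj F i a b) ⊆
      (Finset.univ : Finset (Fin Δ × Finset (Fin M))).biUnion fun q =>
        (Finset.univ.filter fun F : Fin Δ × Sym2 (Fin M) → Fin P =>
          q.2.card = s ∧ ∀ a ∈ q.2, ∀ b ∈ q.2, ¬ randomAdj F q.1 a b) := by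
    intro F hF
    simp only [Finset.mem_filter, Finset.mem_univ, true_and, Finset.mem_biUnion] at hF ⊢
    obtain ⟨i, A, h⟩ := hF
    exact ⟨(i, A), h⟩
  have h1 := (Finset.card_le_card hbig).trans Finset.card_biUnion_le
  set X := (Finset.univ.filter fun F : Fin Δ × Sym2 (Fin M) → Fin P =>
      ∃ i, ∃ A : Finset (Fin M), A.card = s ∧ ∀ a ∈ A, ∀ b ∈ A, ¬ randomAdj F i a b).card
  have h2 : X * 4 ^ M ≤ Δ * 2 ^ M * P ^ N := by
    refine (Nat.mul_le_mul_right _ h1).trans ?_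
    rw [Finset.sum_mul]
    refine (Finset.sum_le_sum fun q _ => hone q.1 q.2).trans ?_
    simp
  have h4 : (4 : ℕ) ^ M = 2 ^ M * 2 ^ M := by rw [← mul_pow]; norm_num
  have h5 : X * 2 ^ M ≤ Δ * P ^ N := by
    refine Nat.le_of_mul_le_mul_right ?_ (show 0 < 2 ^ M by positivity)
    calc X * 2 ^ M * 2 ^ M = X * 4 ^ M := by rw [h4]; ring
      _ ≤ _ := h2
      _ = _ := by ring
  rcases Nat.eq_zero_or_pos Δ with rfl | hΔ
  · have : X = 0 := by simpa using h5
    simp [this]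
  · refine Nat.le_of_mul_le_mul_left ?_ hΔ
    calc Δ * (2 * X) = X * (2 * Δ) := by ring
      _ ≤ X * 2 ^ M := by gcongr
      _ ≤ _ := h5

/-- The coordinates of the edges of a closed walk. -/
def cycleCoord {l : ℕ} (p : (Fin (l + 1) → Fin M) × (Fin (l + 1) → Fin Δ)) (k : Fin (l + 1)) :
    Fin Δ × Sym2 (Fin M) :=
  (p.2 k, s(p.1 k, p.1 (k + 1)))

open Classical in
/-- The vertices at which short cycles start. -/
noncomputable def cycleStarts (g : ℕ) (F : Fin Δ × Sym2 (Fin M) → Fin P) : Finset (Fin M) :=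
  (Finset.range g).biUnion fun l =>
    (Finset.univ.filter fun p : (Fin (l + 1) → Fin M) × (Fin (l + 1) → Fin Δ) =>
      Function.Injective (cycleCoord p) ∧ ∀ k, F (cycleCoord p k) = 0).image fun p => p.1 0

/-- There are `(M * Δ)^(l + 1)` coloured closed sequences of length `l + 1`, and each with distinct
coordinates is present with probability `P^(-(l + 1))`. The expected number is therefore at most `(d
* Δ)^(l + 1)`, and the sum over lengths is geometric with ratio at least 2. -/
lemma sum_card_cycleStarts_le {d : ℕ} (g : ℕ) (hM : M = d * P) (hd : 2 ≤ d * Δ) :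
    ∑ F : Fin Δ × Sym2 (Fin M) → Fin P, (cycleStarts g F).card ≤
      (d * Δ) ^ (g + 1) * P ^ Fintype.card (Fin Δ × Sym2 (Fin M)) := by
  classical
  set N := Fintype.card (Fin Δ × Sym2 (Fin M))
  have hP : 1 ≤ P := NeZero.one_le
  have hone : ∀ l, ∀ p : (Fin (l + 1) → Fin M) × (Fin (l + 1) → Fin Δ),
      (Finset.univ.filter fun F : Fin Δ × Sym2 (Fin M) → Fin P =>
        Function.Injective (cycleCoord p) ∧ ∀ k, F (cycleCoord p k) = 0).card * P ^ (l + 1) ≤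
        P ^ N := by
    intro l p
    by_cases hp : Function.Injective (cycleCoord p)
    · have := card_filter_forall_mem (P := P) (Finset.univ.image (cycleCoord p)) {0}
      rw [Finset.card_image_of_injective _ hp] at this
      simp only [Finset.mem_image, Finset.mem_univ, true_and, forall_exists_index,
        forall_apply_eq_imp_iff, Finset.mem_singleton, Finset.card_univ, Fintype.card_fin,
        Finset.card_singleton, one_pow, one_mul] at this
      simp only [hp, true_and]
      exact this.le
    · simp [hp]
  have hl : ∀ l, ∑ F : Fin Δ × Sym2 (Fin M) → Fin P,
      (Finset.univ.filter fun p : (Fin (l + 1) → Fin M) × (Fin (l + 1) → Fin Δ) =>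
        Function.Injective (cycleCoord p) ∧ ∀ k, F (cycleCoord p k) = 0).card ≤
      (d * Δ) ^ (l + 1) * P ^ N := by
    intro l
    simp only [Finset.card_filter]
    rw [Finset.sum_comm]
    simp only [← Finset.card_filter]
    refine Nat.le_of_mul_le_mul_right ?_ (show 0 < P ^ (l + 1) by positivity)
    rw [Finset.sum_mul]
    refine (Finset.sum_le_sum fun p _ => hone l p).trans (le_of_eq ?_)
    simp only [Finset.sum_const, Finset.card_univ, Fintype.card_prod, Fintype.card_fun,
      Fintype.card_fin, smul_eq_mul]
    conv_lhs => rw [hM]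
    ring
  calc ∑ F : Fin Δ × Sym2 (Fin M) → Fin P, (cycleStarts g F).card
      ≤ ∑ F : Fin Δ × Sym2 (Fin M) → Fin P, ∑ l ∈ Finset.range g,
        (Finset.univ.filter fun p : (Fin (l + 1) → Fin M) × (Fin (l + 1) → Fin Δ) =>
        Function.Injective (cycleCoord p) ∧ ∀ k, F (cycleCoord p k) = 0).card :=
        Finset.sum_le_sum fun F _ => Finset.card_biUnion_le.trans
          (Finset.sum_le_sum fun l _ => Finset.card_image_le)
    _ ≤ ∑ l ∈ Finset.range g, (d * Δ) ^ (l + 1) * P ^ N := by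
        rw [Finset.sum_comm]
        exact Finset.sum_le_sum fun l _ => hl l
    _ ≤ _ := by
        rw [← Finset.sum_mul]
        gcongr
        induction g with
        | zero => simp
        | succ g ih =>
          rw [Finset.sum_range_succ, pow_succ (d * Δ) (g + 1)]
          nlinarith [Nat.pow_pos (n := g + 1) (show 0 < d * Δ by lia)]

end random

/-- Vertices without neighbours of some colour can be removed one by one. -/
lemma exists_pruned {Δ : ℕ} {V : Type} [DecidableEq V] {H : Fin Δ → V → V → Prop}
    (hH : ∀ i a b, H i a b → H i b a) (hirr : ∀ i a, ¬ H i a a) {s : ℕ}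
    (hs : ∀ i (A : Finset V), A.card = s → ∃ a ∈ A, ∃ b ∈ A, H i a b) (W : Finset V) :
    ∃ U ⊆ W, (∀ a ∈ U, ∀ i, ∃ b ∈ U, H i a b) ∧ W.card ≤ U.card + Δ * s := by
  -- `D i` collects the vertices removed for want of a neighbour of colour `i`. It has no edges of
  -- colour `i` inside or to the surviving set, hence never reaches size `s`; this bounds the total
  -- loss by `Δ * s`.
  suffices key : ∀ U : Finset V, ∀ D : Fin Δ → Finset V, (∀ i, ∀ a ∈ D i, ∀ b ∈ D i, ¬ H i a b) →
      (∀ i, ∀ a ∈ D i, ∀ b ∈ U, ¬ H i a b) → (∀ i, Disjoint (D i) U) →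
      W.card ≤ U.card + ∑ i, (D i).card →
      ∃ U' ⊆ U, (∀ a ∈ U', ∀ i, ∃ b ∈ U', H i a b) ∧ W.card ≤ U'.card + Δ * s from
    key W (fun _ => ∅) (by simp) (by simp) (by simp) (by simp)
  intro U
  induction U using Finset.strongInduction with
  | H U ih =>
    intro D hD hDU hdis hW
    by_cases hext : ∀ a ∈ U, ∀ i, ∃ b ∈ U, H i a b
    · refine ⟨U, subset_rfl, hext, hW.trans ?_⟩
      refine Nat.add_le_add_left ?_ _
      calc ∑ i, (D i).card ≤ ∑ _i : Fin Δ, s := Finset.sum_le_sum fun i _ => by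
            by_contra hlt
            obtain ⟨A, hA, hAs⟩ := Finset.exists_subset_card_eq (not_le.1 hlt).le
            obtain ⟨a, ha, b, hb, hab⟩ := hs i A hAs
            exact hD i a (hA ha) b (hA hb) hab
        _ = _ := by simp
    · push Not at hext
      obtain ⟨a, ha, i, hai⟩ := hext
      refine Exists.imp (fun U' h => ⟨h.1.trans (Finset.erase_subset a U), h.2⟩)
        (ih (U.erase a) (Finset.erase_ssubset ha) (Function.update D i (insert a (D i)))
          ?_ ?_ ?_ ?_)
      · intro j
        by_cases hj : j = i
        · subst hj
          simp only [Function.update_self, Finset.mem_insert]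
          rintro b (rfl | hb) b' (rfl | hb')
          · exact hirr _ _
          · exact fun h => hDU j b' hb' b ha (hH _ _ _ h)
          · exact hDU j b hb b' ha
          · exact hD j b hb b' hb'
        · simpa [hj] using hD j
      · intro j
        by_cases hj : j = i
        · subst hj
          simp only [Function.update_self, Finset.mem_insert]
          rintro b (rfl | hb) b' hb'
          · exact hai b' (Finset.mem_of_mem_erase hb')
          · exact hDU j b hb b' (Finset.mem_of_mem_erase hb')
        · simp only [Function.update_of_ne hj]
          exact fun b hb b' hb' => hDU j b hb b' (Finset.mem_of_mem_erase hb')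
      · intro j
        by_cases hj : j = i
        · subst hj
          simp only [Function.update_self, Finset.disjoint_insert_left]
          exact ⟨by simp, (hdis j).mono_right (Finset.erase_subset _ _)⟩
        · simp only [Function.update_of_ne hj]
          exact (hdis j).mono_right (Finset.erase_subset _ _)
      · have ha' : a ∉ D i := fun h => Finset.disjoint_left.1 (hdis i) h ha
        have hsum : ∑ j, (Function.update D i (insert a (D i)) j).card = ∑ j, (D j).card + 1 := by
          rw [← Finset.add_sum_erase _ _ (Finset.mem_univ i),
            ← Finset.add_sum_erase _ (fun j => (D j).card) (Finset.mem_univ i),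
            Finset.sum_congr rfl fun j hj => by
              rw [Function.update_of_ne (Finset.ne_of_mem_erase hj)]]
          simp only [Function.update_self, Finset.card_insert_of_notMem ha']
          lia
        rw [hsum, Finset.card_erase_of_mem ha]
        have := Finset.card_pos.2 ⟨a, ha⟩
        lia

/-- There are small edge-coloured graphs without short cycles in which all large sets of vertices
contain edges of all colours. -/
theorem exists_idGraph {Δ : ℕ} (hΔ : 2 ≤ Δ) (g : ℕ) :
    ∃ M ≤ Δ ^ (14 * g + 27), ∃ (H : Fin Δ → Fin M → Fin M → Prop) (U : Set (Fin M)),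
      (∀ i a b, H i a b → H i b a) ∧ (∀ a ∈ U, ∀ i, ∃ b ∈ U, H i a b) ∧
      (∀ φ : Fin M → Fin Δ × Option (Fin Δ), ∃ a ∈ U, ∃ b ∈ U, H (φ a).1 a b ∧ φ a = φ b) ∧
      NoShortCycle H g := by
  classical
  -- Edges of each colour have probability `1 / P`, so `d` is roughly the degree per colour. `P`
  -- equals the bound on the expected number of cycle starts. The constants are balanced so that `s
  -- * s = 8 * M * P`, as needed for independent sets, while `M = 8 * Δ ^ 2 * s` leaves room for the
  -- pigeonhole argument.
  set d := 512 * Δ ^ 4 with hd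
  set P := (d * Δ) ^ (g + 1) with hP
  set M := d * P with hM
  set s := 64 * Δ ^ 2 * P with hs
  have hPpos : 0 < P := by positivity
  have : NeZero P := ⟨hPpos.ne'⟩
  have hdΔ : 2 ≤ d * Δ := by
    have : 1 ≤ Δ ^ 4 := Nat.one_le_pow _ _ (by lia)
    nlinarith
  have hMs : M = 8 * Δ ^ 2 * s := by rw [hM, hs, hd]; ring
  have hspos : 0 < s := by positivity
  have hΔM : 2 * Δ ≤ 2 ^ M := by
    have : Δ < 2 ^ Δ := Nat.lt_two_pow_self
    have h1 : Δ + 1 ≤ M := by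
      rw [hMs]; nlinarith
    calc 2 * Δ ≤ 2 * 2 ^ Δ := by gcongr
      _ = 2 ^ (Δ + 1) := by ring
      _ ≤ 2 ^ M := Nat.pow_le_pow_right (by lia) h1
  have hs2 : 2 * M * P ≤ s.choose 2 := by
    rw [Nat.choose_two_right, Nat.le_div_iff_mul_le (by lia)]
    have h1 : 2 * M * P * 2 * 2 = s * s := by rw [hM, hs, hd]; ring
    have h2 : s ≤ 2 * (s - 1) := by
      have : 2 ≤ s := by rw [hs]; nlinarith
      lia
    nlinarith
  have hind := card_independent_le (P := P) hΔM hs2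
  have hcyc := sum_card_cycleStarts_le (P := P) g hM hdΔ
  set N := Fintype.card (Fin Δ × Sym2 (Fin M))
  set bad : (Fin Δ × Sym2 (Fin M) → Fin P) → Prop := fun F =>
    ∃ i, ∃ A : Finset (Fin M), A.card = s ∧ ∀ a ∈ A, ∀ b ∈ A, ¬ randomAdj F i a b
  -- Both requirements are met by one averaging: the first term has mean at most `2 * P < s` and the
  -- second at most `s`. A value below `2 * s` excludes a bad `F` and leaves fewer than `s` cycle
  -- starts.
  obtain ⟨F, -, hF⟩ : ∃ F ∈ (Finset.univ : Finset (Fin Δ × Sym2 (Fin M) → Fin P)),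
      2 * (cycleStarts g F).card + s * (2 * if bad F then 1 else 0) < 2 * s := by
    refine Finset.exists_lt_of_sum_lt ?_
    rw [Finset.sum_add_distrib, ← Finset.mul_sum, ← Finset.mul_sum, ← Finset.mul_sum,
      Finset.sum_boole, Finset.sum_const, Finset.card_univ, Fintype.card_fun, Fintype.card_fin]
    have h1 : 2 * (P * P ^ N) < s * P ^ N := by
      have : 0 < P ^ N := by positivity
      have h2 : 2 * P < s := by
        have : 4 ≤ Δ ^ 2 := by nlinarith
        rw [hs]; nlinarith
      nlinarith
    have h3 : s * (2 * (Finset.univ.filter bad).card) ≤ s * P ^ N := by gcongr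
    simp only [Nat.cast_id, smul_eq_mul]
    lia
  have hnb : ¬ bad F := by
    intro h
    rw [if_pos h] at hF
    lia
  rw [if_neg hnb] at hF
  have hs' : ∀ i (A : Finset (Fin M)), A.card = s → ∃ a ∈ A, ∃ b ∈ A, randomAdj F i a b := by
    intro i A hA
    by_contra hno
    push Not at hno
    exact hnb ⟨i, A, hA, hno⟩
  obtain ⟨U, hUW, hext, hU⟩ := exists_pruned (fun i a b h => h.symm) (fun i a h => h.1 rfl) hs'
    (cycleStarts g F)ᶜ
  rw [Finset.card_compl, Fintype.card_fin] at hU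
  refine ⟨M, ?_, fun i a b => randomAdj F i a b ∧ a ∈ U ∧ b ∈ U, U,
    fun i a b h => ⟨h.1.symm, h.2.2, h.2.1⟩, ?_, ?_, ?_⟩
  · have h9 : 512 ≤ Δ ^ 9 := (Nat.pow_le_pow_left hΔ 9 : 2 ^ 9 ≤ Δ ^ 9)
    calc M = d * (d * Δ) ^ (g + 1) := rfl
      _ ≤ Δ ^ 13 * (Δ ^ 14) ^ (g + 1) := by
        have : d ≤ Δ ^ 13 := by
          calc d ≤ Δ ^ 9 * Δ ^ 4 := Nat.mul_le_mul_right _ h9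
            _ = _ := by ring
        gcongr
        calc d * Δ ≤ Δ ^ 13 * Δ := by gcongr
          _ = _ := by ring
      _ = _ := by rw [← pow_mul, ← pow_add]; congr 1; ring
  · intro a ha i
    obtain ⟨b, hb, h⟩ := hext a ha i
    exact ⟨b, hb, h, ha, hb⟩
  · intro φ
    -- At most `s + Δ * s` vertices were deleted, so more than `Δ * (Δ + 1) * s` survive, and some
    -- value of `φ` is taken more than `s` times.
    obtain ⟨q, -, hq⟩ := Finset.exists_lt_card_fiber_of_mul_lt_card_of_maps_to (s := U)
      (t := Finset.univ) (f := φ) (n := s) (fun _ _ => Finset.mem_univ _) (by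
        simp only [Finset.card_univ, Fintype.card_prod, Fintype.card_fin, Fintype.card_option]
        have : Δ * (Δ + 1) * s + Δ * s + s < M := by rw [hMs]; nlinarith
        lia)
    obtain ⟨A, hA, hAs⟩ := Finset.exists_subset_card_eq hq.le
    obtain ⟨a, ha, b, hb, hab⟩ := hs' q.1 A hAs
    have ha' := Finset.mem_filter.1 (hA ha)
    have hb' := Finset.mem_filter.1 (hA hb)
    exact ⟨a, ha'.1, b, hb'.1, ⟨by rw [ha'.2]; exact hab, ha'.1, hb'.1⟩, ha'.2.trans hb'.2.symm⟩
  · rintro L hL hLg v c hinj hv0 hadj hc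
    obtain ⟨l, rfl⟩ : ∃ l, L = l + 1 := ⟨L - 1, by lia⟩
    have hstart : v 0 ∉ cycleStarts g F :=
      Finset.mem_compl.1 (hUW (hadj 0 (by lia)).2.1)
    refine hstart ?_
    let p : (Fin (l + 1) → Fin M) × (Fin (l + 1) → Fin Δ) := (fun k => v k, fun k => c k)
    have hp : ∀ k : Fin (l + 1), p.1 (k + 1) = v (k + 1) := by
      intro k
      simp only [p, Fin.val_add_one]
      split_ifs with h
      · subst h
        simpa using hv0.symm
      · rfl
    have hcoord : ∀ k : Fin (l + 1), cycleCoord p k = (c k, s(v k, v (k + 1))) := fun k => by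
      rw [cycleCoord, hp]
    -- With distinct vertices, an edge can repeat only as two consecutive steps back and forth; then
    -- the colours differ.
    have hne : ∀ k k' : Fin (l + 1), k < k' → cycleCoord p k ≠ cycleCoord p k' := by
      intro k k' hkk h
      rw [hcoord, hcoord, Prod.mk.injEq, Sym2.eq_iff] at h
      have hk' := k'.2
      have hkk' : (k : ℕ) < k' := hkk
      rcases h with ⟨h1, ⟨h2, -⟩ | ⟨-, h2⟩⟩
      · have := hinj (Set.mem_Iio.2 k.2) (Set.mem_Iio.2 k'.2) h2
        lia
      · have := hinj (Set.mem_Iio.2 (by lia)) (Set.mem_Iio.2 k'.2) h2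
        rw [← this] at h1
        exact hc k (by lia) h1
    simp only [cycleStarts, Finset.mem_biUnion, Finset.mem_range, Finset.mem_image,
      Finset.mem_filter, Finset.mem_univ, true_and]
    refine ⟨l, by lia, p, ⟨fun k k' h => ?_, fun k => ?_⟩, rfl⟩
    · rcases lt_trichotomy k k' with hlt | heq | hlt
      · exact (hne _ _ hlt h).elim
      · exact heq
      · exact (hne _ _ hlt h.symm).elim
    · rw [hcoord]
      exact (hadj k k.2).1.2

end RegTree

/-! ### Labels in a ball are distinct -/

namespace RegTree

variable {Δ : ℕ} {V : Type}

lemma shift_apply (w v : List (Fin Δ)) (x : List (Fin Δ) → V) :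
    shift w x v = x (w.foldr step v) := by
  induction w generalizing x with
  | nil => rfl
  | cons i w ih => rw [shift_cons, ih, reroot, List.foldr_cons]

lemma foldr_step_of_reduced {w v : List (Fin Δ)} (h : Reduced (w ++ v)) :
    w.foldr step v = w ++ v := by
  induction w with
  | nil => rfl
  | cons i w ih =>
    rw [List.foldr_cons, ih h.tail]
    exact step_of_reduced_cons h

lemma shift_apply_of_reduced {w v : List (Fin Δ)} (h : Reduced (w ++ v))
    (x : List (Fin Δ) → V) : shift w x v = x (w ++ v) := by
  rw [shift_apply, foldr_step_of_reduced h]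

/-- The vertex `w'`, seen from the vertex `w`. -/
def relative (w w' : List (Fin Δ)) : List (Fin Δ) := w.foldl (fun v i => step i v) w'

lemma foldr_step_relative (w : List (Fin Δ)) {w' : List (Fin Δ)} (h : Reduced w') :
    w.foldr step (relative w w') = w' := by
  induction w generalizing w' with
  | nil => rfl
  | cons i w ih =>
    change step i (w.foldr step (relative w (step i w'))) = w'
    rw [ih (reduced_step h), step_step i h]

lemma reduced_relative (w : List (Fin Δ)) {w' : List (Fin Δ)} (h : Reduced w') :
    Reduced (relative w w') := by
  induction w generalizing w' with
  | nil => exact h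
  | cons i w ih => exact ih (reduced_step h)

lemma length_relative_le (w w' : List (Fin Δ)) :
    (relative w w').length ≤ w.length + w'.length := by
  induction w generalizing w' with
  | nil => simp [relative]
  | cons i w ih =>
    have := length_step_le i w'
    have h := ih (step i w')
    rw [List.length_cons]
    change (relative w (step i w')).length ≤ _
    lia

/-- The labels along `u` form a walk in the ID graph whose consecutive colours differ, as `u` is
reduced. If it closed up, it would be a short cycle; an earlier coincidence on the way is excluded
by induction, after moving the root to its first vertex. -/
lemma IsLabelling.ne_root {H : Fin Δ → V → V → Prop} (hH : ∀ i a b, H i a b → H i b a) {g : ℕ}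
    (hg : NoShortCycle H g) {u : List (Fin Δ)} (hu : Reduced u) (hne : u ≠ [])
    (hlen : u.length ≤ g) {x : List (Fin Δ) → V} (hx : IsLabelling H x) : x u ≠ x [] := by
  induction hn : u.length using Nat.strong_induction_on generalizing u x with
  | _ n ih =>
  intro heq
  subst hn
  refine hg u.length (List.length_pos_iff.2 hne) hlen (fun k => x (u.take k))
    (fun k => u.getD k (u.head hne)) ?_ (by simpa using heq) ?_ ?_
  · have key : ∀ k l, k < l → l < u.length → x (u.take k) ≠ x (u.take l) := by
      intro k l hkl hl h
      have hsplit : u.take k ++ (u.take l).drop k = u.take l := by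
        have := List.take_append_drop k (u.take l)
        rwa [List.take_take, min_eq_left hkl.le] at this
      have hred : Reduced (u.take l) := hu.take l
      refine ih (l - k) (by lia) (u := (u.take l).drop k) (x := RegTree.shift (u.take k) x)
        (hred.drop k) ?_ (by simp; lia) (hx.shift hH _) (by simp; lia) ?_
      · intro h0
        have := congrArg List.length h0
        simp at this
        lia
      · rw [shift_apply_of_reduced (by rw [hsplit]; exact hred), hsplit,
          shift_apply_of_reduced (by simpa using hu.take k), List.append_nil, h]
    intro k hk l hl h
    simp only [Set.mem_Iio] at hk hl
    rcases lt_trichotomy k l with hlt | heq | hlt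
    · exact (key k l hlt hl h).elim
    · exact heq
    · exact (key l k hlt hk h.symm).elim
  · intro k hk
    have h1 : u.take (k + 1) = u.take k ++ [u[k]] := List.take_succ_eq_append_getElem hk
    have h2 := hx (u.take k) u[k] (by rw [← h1]; exact hu.take _)
    rw [← h1] at h2
    simp only [List.getD_eq_getElem _ _ hk]
    exact h2
  · intro k hk
    rw [List.getD_eq_getElem _ _ (by lia), List.getD_eq_getElem _ _ hk]
    exact List.isChain_iff_getElem.1 hu k hk

/-- Two vertices of the ball of radius `R` are at distance at most `2 * R`. Seen from the first, the
second is a word of at most that length, and `ne_root` applies. -/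
lemma IsLabelling.eq_of_eq {H : Fin Δ → V → V → Prop} (hH : ∀ i a b, H i a b → H i b a) {R : ℕ}
    (hg : NoShortCycle H (2 * R)) {x : List (Fin Δ) → V} (hx : IsLabelling H x)
    {w w' : List (Fin Δ)} (hw : Reduced w) (hw' : Reduced w') (hl : w.length ≤ R)
    (hl' : w'.length ≤ R) (h : x w = x w') : w = w' := by
  have h0 : relative w w' = [] := by
    by_contra hne
    refine (hx.shift hH w).ne_root hH hg (reduced_relative w hw') hne
      ((length_relative_le w w').trans (by lia)) ?_
    rw [shift_apply, shift_apply, foldr_step_relative w hw',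
      foldr_step_of_reduced (by simpa using hw), List.append_nil, h]
  have := foldr_step_relative w hw'
  rwa [h0, foldr_step_of_reduced (by simpa using hw), List.append_nil] at this

/-! ### Finite subtrees -/

lemma reduced_append_singleton {w : List (Fin Δ)} {i : Fin Δ} :
    Reduced (w ++ [i]) ↔ Reduced w ∧ w.getLast? ≠ some i := by
  rw [Reduced, List.isChain_append]
  simp only [List.isChain_singleton, List.head?_cons, Option.mem_def, Option.some.injEq,
    forall_eq', true_and, and_congr_right_iff]
  intro _
  exact ⟨fun h h' => h i h' rfl, fun h j hj e => h (e ▸ hj)⟩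

/-- The neighbour of the vertex `w` behind the edge of colour `i`. -/
def adjWord (i : Fin Δ) (w : List (Fin Δ)) : List (Fin Δ) :=
  if w.getLast? = some i then w.dropLast else w ++ [i]

@[simp] lemma adjWord_append_self (i : Fin Δ) (w : List (Fin Δ)) : adjWord i (w ++ [i]) = w := by
  simp [adjWord]

lemma adjWord_of_reduced {i : Fin Δ} {w : List (Fin Δ)} (h : Reduced (w ++ [i])) :
    adjWord i w = w ++ [i] := by
  simp [adjWord, (reduced_append_singleton.1 h).2]

lemma adjWord_cases {i : Fin Δ} {w : List (Fin Δ)} (h : Reduced w) :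
    (∃ v, w = v ++ [i] ∧ adjWord i w = v) ∨ (Reduced (w ++ [i]) ∧ adjWord i w = w ++ [i]) := by
  by_cases hl : w.getLast? = some i
  · left
    obtain ⟨v, rfl⟩ := List.getLast?_eq_some_iff.1 hl
    exact ⟨v, rfl, by simp⟩
  · right
    have := reduced_append_singleton.2 ⟨h, hl⟩
    exact ⟨this, adjWord_of_reduced this⟩

lemma adjWord_adjWord (i : Fin Δ) {w : List (Fin Δ)} (h : Reduced w) :
    adjWord i (adjWord i w) = w := by
  rcases adjWord_cases (i := i) h with ⟨v, rfl, h'⟩ | ⟨_, h'⟩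
  · rw [h', adjWord_of_reduced h]
  · rw [h', adjWord_append_self]

lemma length_adjWord_le (i : Fin Δ) (w : List (Fin Δ)) :
    (adjWord i w).length ≤ w.length + 1 := by
  rw [adjWord]
  split_ifs
  · simp; lia
  · simp

lemma adjWord_injective {w : List (Fin Δ)} (h : Reduced w) :
    Function.Injective fun i => adjWord i w := by
  intro i j hij
  dsimp only at hij
  rcases adjWord_cases (i := i) h with ⟨v, hv, h'⟩ | ⟨_, h'⟩ <;>
    rcases adjWord_cases (i := j) h with ⟨u, hu, h''⟩ | ⟨_, h''⟩ <;> rw [h', h''] at hij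
  · subst hij
    simpa using hv.symm.trans hu
  · subst hij
    simp at hv
  · subst hij
    simp at hu
  · simpa using hij

lemma agree_shift_adjWord (T : ℕ) (i : Fin Δ) {w : List (Fin Δ)} (h : Reduced w)
    (x : List (Fin Δ) → V) : Agree T (shift (adjWord i w) x) (reroot i (shift w x)) := by
  rcases adjWord_cases (i := i) h with ⟨v, rfl, h'⟩ | ⟨_, h'⟩
  · rw [h', shift_append_singleton]
    exact (agree_reroot_reroot _ _ _).symm
  · rw [h', shift_append_singleton]
    exact Agree.refl _ _

/-- A finite set of vertices of the infinite tree that spans a subtree that contains the root. -/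
structure IsSubtree (F : Finset (List (Fin Δ))) : Prop where
  reduced : ∀ w ∈ F, Reduced w
  nil_mem : [] ∈ F
  mem_of_append : ∀ w i, w ++ [i] ∈ F → w ∈ F

/-- All vertices are leaves or have all of their neighbours in the set. -/
def IsRegularSubtree (F : Finset (List (Fin Δ))) : Prop :=
  ∀ w ∈ F, (∀ i, adjWord i w ∈ F) ∨ (w ≠ [] ∧ ∀ i, w ++ [i] ∉ F)

/-- The subgraph of the infinite tree on a finite set of vertices. -/
def subtreeGraph (F : Finset (List (Fin Δ))) : SimpleGraph F where
  Adj a b := ∃ i, b.1 = a.1 ++ [i] ∨ a.1 = b.1 ++ [i]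
  symm := ⟨fun _ _ ⟨i, h⟩ => ⟨i, h.symm⟩⟩
  loopless := ⟨fun a ⟨i, h⟩ => by
    rcases h with h | h <;> simpa using congrArg List.length h⟩

variable {F : Finset (List (Fin Δ))}

lemma subtreeGraph_adj_iff (hF : IsSubtree F) {a b : F} :
    (subtreeGraph F).Adj a b ↔ ∃ i, b.1 = adjWord i a.1 := by
  refine exists_congr fun i => ?_
  constructor
  · rintro (h | h)
    · rw [h, adjWord_of_reduced]
      rw [← h]
      exact hF.reduced _ b.2
    · rw [h, adjWord_append_self]
  · intro h
    rcases adjWord_cases (i := i) (hF.reduced _ a.2) with ⟨v, hv, h'⟩ | ⟨_, h'⟩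
    · right
      rw [h, h', hv]
    · left
      rw [h, h']

lemma IsSubtree.isTree (hF : IsSubtree F) : (subtreeGraph F).IsTree := by
  classical
  have hconn : (subtreeGraph F).Connected := by
    have key : ∀ w (hw : w ∈ F), (subtreeGraph F).Reachable ⟨w, hw⟩ ⟨[], hF.nil_mem⟩ := by
      intro w
      induction w using List.reverseRecOn with
      | nil => exact fun _ => SimpleGraph.Reachable.refl _
      | append_singleton w i ih =>
        intro hw
        have hw' := hF.mem_of_append w i hw
        refine SimpleGraph.Reachable.trans (SimpleGraph.Adj.reachable ?_) (ih hw')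
        exact ⟨i, Or.inr rfl⟩
    have : Nonempty F := ⟨⟨[], hF.nil_mem⟩⟩
    exact ⟨fun a b => (key a.1 a.2).trans (key b.1 b.2).symm⟩
  rw [SimpleGraph.isTree_iff_connected_and_card]
  refine ⟨hconn, le_antisymm ?_ hconn.card_vert_le_card_edgeSet_add_one⟩
  let root : F := ⟨[], hF.nil_mem⟩
  have hlast : ∀ w : {w : F // w ≠ root}, ∃ v i, w.1.1 = v ++ [i] := by
    rintro ⟨⟨w, hw⟩, hne⟩
    rcases List.eq_nil_or_concat w with h | ⟨v, i, h⟩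
    · exact (hne (Subtype.ext h)).elim
    · exact ⟨v, i, by simpa using h⟩
  choose par lst hpar using hlast
  have hparF : ∀ w, par w ∈ F := fun w => hF.mem_of_append _ (lst w) (by
    rw [← hpar w]
    exact w.1.2)
  -- Every edge joins a vertex other than the root to its parent, so there are at most `card F - 1`
  -- edges.
  let E : {w : F // w ≠ root} → (subtreeGraph F).edgeSet := fun w =>
    ⟨s(w.1, ⟨par w, hparF w⟩), ⟨lst w, Or.inr (hpar w)⟩⟩
  have hE : Function.Surjective E := by
    have key : ∀ a b : F, ∀ i, b.1 = a.1 ++ [i] → ∃ w, (E w).1 = s(b, a) := by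
      intro a b i h
      have hb : b ≠ root := by
        intro h'
        have := congrArg Subtype.val h'
        simp [root, h] at this
      refine ⟨⟨b, hb⟩, ?_⟩
      have h1 := hpar ⟨b, hb⟩
      have h2 : par ⟨b, hb⟩ = a.1 := (List.append_inj' (h1.symm.trans h) (by simp)).1
      simp only [E]
      congr 2
    rintro ⟨e, he⟩
    induction e using Sym2.ind with
    | _ a b =>
      obtain ⟨i, h | h⟩ := he
      · obtain ⟨w, hw⟩ := key a b i h
        exact ⟨w, Subtype.ext (hw.trans Sym2.eq_swap)⟩
      · obtain ⟨w, hw⟩ := key b a i h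
        exact ⟨w, Subtype.ext hw⟩
  have h1 := Nat.card_le_card_of_surjective E hE
  have h2 : Nat.card {w : F // w ≠ root} = Nat.card F - 1 := by
    rw [Nat.card_eq_fintype_card, Nat.card_eq_fintype_card, Fintype.card_subtype_compl,
      Fintype.card_subtype_eq]
  have h3 : 0 < Nat.card F := Nat.card_pos_iff.2 ⟨⟨root⟩, inferInstance⟩
  lia

lemma neighborSet_subset (hF : IsSubtree F) (a : F) :
    Subtype.val '' (subtreeGraph F).neighborSet a ⊆ Set.range fun i => adjWord i a.1 := by
  rintro _ ⟨b, hb, rfl⟩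
  obtain ⟨i, hi⟩ := (subtreeGraph_adj_iff hF).1 hb
  exact ⟨i, hi.symm⟩

lemma encard_range_adjWord {w : List (Fin Δ)} (h : Reduced w) :
    (Set.range fun i => adjWord i w).encard = Δ := by
  rw [← Set.image_univ, (adjWord_injective h).encard_image]
  simp

lemma encard_neighborSet_le (hF : IsSubtree F) (a : F) :
    ((subtreeGraph F).neighborSet a).encard ≤ Δ := by
  rw [← Subtype.val_injective.encard_image, ← encard_range_adjWord (hF.reduced _ a.2)]
  exact Set.encard_le_encard (neighborSet_subset hF a)

lemma encard_neighborSet_eq (hF : IsSubtree F) {a : F} (ha : ∀ i, adjWord i a.1 ∈ F) :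
    ((subtreeGraph F).neighborSet a).encard = Δ := by
  rw [← Subtype.val_injective.encard_image, ← encard_range_adjWord (hF.reduced _ a.2)]
  refine congrArg _ ((neighborSet_subset hF a).antisymm ?_)
  rintro _ ⟨i, rfl⟩
  exact ⟨⟨_, ha i⟩, (subtreeGraph_adj_iff hF).2 ⟨i, rfl⟩, rfl⟩

lemma IsRegularSubtree.isRegularTree (hF : IsSubtree F) (hreg : IsRegularSubtree F) :
    IsRegularTree (subtreeGraph F) Δ := by
  refine ⟨hF.isTree, fun a => ?_⟩
  rcases hreg a.1 a.2 with h | ⟨hne, h⟩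
  · exact Or.inr (encard_neighborSet_eq hF h)
  · left
    rcases List.eq_nil_or_concat a.1 with h0 | ⟨v, i, h0⟩
    · exact (hne h0).elim
    · have hv : a.1 = v ++ [i] := by simpa using h0
      have hvF : v ∈ F := hF.mem_of_append v i (hv ▸ a.2)
      rw [Set.encard_eq_one]
      refine ⟨⟨v, hvF⟩, Set.eq_singleton_iff_unique_mem.2 ⟨⟨i, Or.inr hv⟩, ?_⟩⟩
      rintro b ⟨j, hb | hb⟩
      · exact (h j (hb ▸ b.2)).elim
      · exact Subtype.ext (List.append_inj' (hb.symm.trans hv) (by simp)).1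

/-- The number of vertices of a regular tree. -/
lemma exists_card_eq_of_isRegularTree {W : Type} [Fintype W] {G : SimpleGraph W}
    (hG : IsRegularTree G Δ) (hΔ : 2 ≤ Δ) : ∃ k, Fintype.card W = 2 + k * (Δ - 1) := by
  classical
  have h1 := G.sum_degrees_eq_twice_card_edges
  have h2 := hG.1.card_edgeFinset
  have hdeg : ∀ v, G.degree v = 1 + if G.degree v = Δ then Δ - 1 else 0 := by
    intro v
    have h : (G.neighborSet v).encard = G.degree v := by
      rw [← G.card_neighborSet_eq_degree, Set.encard_eq_coe_toFinset_card, Set.toFinset_card]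
    rcases hG.2 v with hv | hv <;> rw [h] at hv <;> norm_cast at hv <;> rw [hv]
    · rw [if_neg (by lia)]
    · rw [if_pos rfl]; lia
  rw [Finset.sum_congr rfl fun v _ => hdeg v, Finset.sum_add_distrib, Finset.sum_ite] at h1
  simp only [Finset.sum_const, Finset.card_univ, smul_eq_mul, mul_one, mul_zero, add_zero] at h1
  exact ⟨(Finset.univ.filter fun v => G.degree v = Δ).card, by lia⟩

/-- The vertices at distance at most `R` from the root. -/
def ball (Δ R : ℕ) : Finset (List (Fin Δ)) :=
  ((Finset.range (R + 1)).biUnion fun k =>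
    (Finset.univ : Finset (Fin k → Fin Δ)).image List.ofFn).filter fun w => Reduced w

lemma mem_ball {R : ℕ} {w : List (Fin Δ)} : w ∈ ball Δ R ↔ Reduced w ∧ w.length ≤ R := by
  simp only [ball, Finset.mem_filter, Finset.mem_biUnion, Finset.mem_range, Finset.mem_image,
    Finset.mem_univ, true_and]
  constructor
  · rintro ⟨⟨k, hk, f, rfl⟩, h⟩
    exact ⟨h, by simp; lia⟩
  · rintro ⟨h, hl⟩
    exact ⟨⟨w.length, by lia, w.get, List.ofFn_get w⟩, h⟩

lemma card_ball_le (hΔ : 2 ≤ Δ) (R : ℕ) : (ball Δ R).card ≤ Δ ^ (R + 1) := by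
  refine (Finset.card_filter_le _ _).trans (Finset.card_biUnion_le.trans ?_)
  refine (Finset.sum_le_sum fun k _ => Finset.card_image_le).trans ?_
  simp only [Finset.card_univ, Fintype.card_fun, Fintype.card_fin]
  exact (Nat.geomSum_lt hΔ (by simp)).le

lemma isSubtree_ball (R : ℕ) : IsSubtree (ball Δ R) where
  reduced w hw := (mem_ball.1 hw).1
  nil_mem := mem_ball.2 ⟨by simp [Reduced], by simp⟩
  mem_of_append w i h := by
    rw [mem_ball] at h ⊢
    have := h.2
    rw [List.length_append] at this
    exact ⟨h.1.left_of_append, by lia⟩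

lemma reduced_adjWord (i : Fin Δ) {w : List (Fin Δ)} (h : Reduced w) : Reduced (adjWord i w) := by
  rcases adjWord_cases (i := i) h with ⟨v, rfl, h'⟩ | ⟨h1, h'⟩ <;> rw [h']
  · exact h.left_of_append
  · exact h1

lemma isRegularSubtree_ball {R : ℕ} (hR : 1 ≤ R) : IsRegularSubtree (ball Δ R) := by
  intro w hw
  obtain ⟨hw, hl⟩ := mem_ball.1 hw
  rcases hl.lt_or_eq with h | h
  · exact Or.inl fun i => mem_ball.2 ⟨reduced_adjWord i hw, (length_adjWord_le i w).trans h⟩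
  · refine Or.inr ⟨?_, fun i hi => ?_⟩
    · rintro rfl
      simp at h
      lia
    · have := (mem_ball.1 hi).2
      simp at this
      lia

lemma exists_subtree_extension (hΔ : 2 ≤ Δ) {n : ℕ} (hF : IsSubtree F) (hreg : IsRegularSubtree F)
    (hne : ∃ w ∈ F, w ≠ []) (hn : F.card ≤ n) :
    ∃ F', F ⊆ F' ∧ IsSubtree F' ∧ F'.card = n ∧
      ((Δ - 1) ∣ n - F.card → IsRegularSubtree F') := by
  classical
  induction hk : n - F.card using Nat.strong_induction_on generalizing F with
  | _ k ih =>
  rcases Nat.eq_zero_or_pos k with h0 | hpos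
  · exact ⟨F, subset_rfl, hF, by lia, fun _ => hreg⟩
  -- A deepest vertex is a leaf and its children are all new. Adding all `Δ - 1` of them preserves
  -- regularity; an incomplete batch is only needed at the end, and never if `Δ - 1` divides the
  -- missing number.
  obtain ⟨w, hwF, hmax⟩ := Finset.exists_max_image F List.length ⟨[], hF.nil_mem⟩
  have hw0 : w ≠ [] := by
    rintro rfl
    obtain ⟨v, hv, hv0⟩ := hne
    have := hmax v hv
    simp at this
    exact hv0 this
  obtain ⟨j, hj⟩ : ∃ j, w.getLast? = some j :=
    ⟨_, List.getLast?_eq_some_getLast hw0⟩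
  set C : Finset (List (Fin Δ)) := (Finset.univ.erase j).image fun i => w ++ [i] with hC
  have hCcard : C.card = Δ - 1 := by
    rw [hC, Finset.card_image_of_injective _ (fun a b h => by simpa using h),
      Finset.card_erase_of_mem (Finset.mem_univ _), Finset.card_univ, Fintype.card_fin]
  have hCmem : ∀ v ∈ C, ∃ i, i ≠ j ∧ v = w ++ [i] := by
    intro v hv
    simp only [hC, Finset.mem_image, Finset.mem_erase, Finset.mem_univ, and_true] at hv
    obtain ⟨i, hi, rfl⟩ := hv
    exact ⟨i, hi, rfl⟩
  have hdisj : Disjoint F C := by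
    rw [Finset.disjoint_left]
    intro v hv hv'
    obtain ⟨i, -, rfl⟩ := hCmem v hv'
    have := hmax _ hv
    simp at this
  have hsub : ∀ C' ⊆ C, IsSubtree (F ∪ C') := by
    intro C' hC'
    refine ⟨?_, Finset.mem_union_left _ hF.nil_mem, ?_⟩
    · intro v hv
      rcases Finset.mem_union.1 hv with hv | hv
      · exact hF.reduced v hv
      · obtain ⟨i, hi, rfl⟩ := hCmem v (hC' hv)
        refine reduced_append_singleton.2 ⟨hF.reduced _ hwF, ?_⟩
        rw [hj]
        simpa using hi.symm
    · intro v i hv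
      refine Finset.mem_union_left _ ?_
      rcases Finset.mem_union.1 hv with hv | hv
      · exact hF.mem_of_append v i hv
      · obtain ⟨i', hi, h⟩ := hCmem _ (hC' hv)
        rw [(List.append_inj' h (by simp)).1]
        exact hwF
  rcases le_or_gt (Δ - 1) k with hle | hlt
  · have hcard : (F ∪ C).card = F.card + (Δ - 1) := by
      rw [Finset.card_union_of_disjoint hdisj, hCcard]
    have hreg' : IsRegularSubtree (F ∪ C) := by
      intro v hv
      rcases Finset.mem_union.1 hv with hvF | hv
      · by_cases hvw : v = w
        · subst hvw
          left
          intro i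
          rcases adjWord_cases (i := i) (hF.reduced _ hvF) with ⟨u, hu, h'⟩ | ⟨h1, h'⟩ <;> rw [h']
          · exact Finset.mem_union_left _ (hF.mem_of_append u i (hu ▸ hvF))
          · refine Finset.mem_union_right _ ?_
            rw [hC, Finset.mem_image]
            refine ⟨i, ?_, rfl⟩
            have := (reduced_append_singleton.1 h1).2
            rw [hj] at this
            simp only [Finset.mem_erase, Finset.mem_univ, and_true]
            exact fun e => this (by rw [e])
        · rcases hreg v hvF with h | ⟨h1, h2⟩
          · exact Or.inl fun i => Finset.mem_union_left _ (h i)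
          · refine Or.inr ⟨h1, fun i hi => ?_⟩
            rcases Finset.mem_union.1 hi with hi | hi
            · exact h2 i hi
            · obtain ⟨i', -, h⟩ := hCmem _ hi
              exact hvw (List.append_inj' h (by simp)).1
      · obtain ⟨i, -, rfl⟩ := hCmem v hv
        refine Or.inr ⟨by simp, fun i' hi' => ?_⟩
        rcases Finset.mem_union.1 hi' with hi' | hi'
        · have := hmax _ hi'
          simp at this
        · obtain ⟨i'', -, h⟩ := hCmem _ hi'
          have := congrArg List.length h
          simp at this
    obtain ⟨F', h1, h2, h3, h4⟩ := ih (n - (F ∪ C).card) (by rw [hcard]; lia) (hsub C subset_rfl)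
      hreg' ⟨w, Finset.mem_union_left _ hwF, hw0⟩ (by rw [hcard]; lia) rfl
    refine ⟨F', Finset.subset_union_left.trans h1, h2, h3, fun hdvd => h4 ?_⟩
    rw [hcard]
    have : n - (F.card + (Δ - 1)) = k - (Δ - 1) := by lia
    rw [this]
    exact Nat.dvd_sub hdvd dvd_rfl
  · obtain ⟨C', hC', hcard⟩ := Finset.exists_subset_card_eq (s := C) (n := k) (by rw [hCcard]; lia)
    refine ⟨F ∪ C', Finset.subset_union_left, hsub C' hC', ?_, fun hdvd => ?_⟩
    · rw [Finset.card_union_of_disjoint (hdisj.mono_right hC'), hcard]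
      lia
    · exact absurd (Nat.le_of_dvd hpos hdvd) (by lia)

lemma exists_subtree (hΔ : 2 ≤ Δ) {n R : ℕ} (hR : 1 ≤ R) (hn : Δ ^ (R + 1) ≤ n) :
    ∃ F, IsSubtree F ∧ F.card = n ∧ ball Δ R ⊆ F ∧
      ((∃ G : SimpleGraph (Fin n), IsRegularTree G Δ) → IsRegularSubtree F) := by
  have hreg := isRegularSubtree_ball (Δ := Δ) hR
  have hball := isSubtree_ball (Δ := Δ) R
  have hcard := (card_ball_le hΔ R).trans hn
  obtain ⟨F, h1, h2, h3, h4⟩ := exists_subtree_extension hΔ hball hreg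
    ⟨[⟨0, by lia⟩], mem_ball.2 ⟨by simp [Reduced], by simpa using hR⟩, by simp⟩ hcard
  refine ⟨F, h2, h3, h1, fun ⟨G, hG⟩ => h4 ?_⟩
  -- Both `n` and the size of the ball are congruent to 2 modulo `Δ - 1`, so full batches of
  -- children reach `n` exactly.
  obtain ⟨k, hk⟩ := exists_card_eq_of_isRegularTree hG hΔ
  obtain ⟨k', hk'⟩ := exists_card_eq_of_isRegularTree (hreg.isRegularTree hball) hΔ
  rw [Fintype.card_fin] at hk
  rw [Fintype.card_coe] at hk'
  refine ⟨k - k', ?_⟩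
  rw [hk, hk', Nat.add_sub_add_left, ← Nat.sub_mul, mul_comm]

end RegTree

/-! ### Networks that contain a ball of the infinite tree -/

namespace RegTree

variable {Δ : ℕ}

/-- A graph with port numbers that contains the ball of radius `R` of the infinite tree, with the
edge colours as port numbers at the inner vertices of the ball. -/
structure Host (Δ R n : ℕ) where
  graph : SimpleGraph (Fin n)
  deg : Fin n → ℕ
  port : (v : Fin n) → Fin (deg v) ≃ graph.neighborSet v
  /-- the position of a vertex in the infinite tree -/
  word : Fin n → List (Fin Δ)
  word_injective : Function.Injective word
  word_reduced : ∀ v, Reduced (word v)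
  exists_word : ∀ w, Reduced w → w.length ≤ R → ∃ v, word v = w
  deg_eq : ∀ v, (word v).length < R → deg v = Δ
  word_port : ∀ v, (word v).length < R → ∀ (i : Fin (deg v)) (j : Fin Δ), (i : ℕ) = j →
    word (port v i).1 = adjWord j (word v)

/-- There is a host among the trees of maximum degree `Δ`, and among the regular trees. -/
theorem exists_host (hΔ : 2 ≤ Δ) {n R : ℕ} (hR : 1 ≤ R) (hn : Δ ^ (R + 1) ≤ n)
    {𝒢 : SimpleGraph (Fin n) → Prop}
    (h𝒢 : (∀ G, G.IsTree → HasMaxDegree G Δ → 𝒢 G) ∨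
      ((∃ G : SimpleGraph (Fin n), IsRegularTree G Δ) ∧ ∀ G, IsRegularTree G Δ → 𝒢 G)) :
    ∃ h : Host Δ R n, 𝒢 h.graph := by
  classical
  obtain ⟨F, hF, hcard, hball, hreg⟩ := exists_subtree hΔ hR hn
  let e : Fin n ≃ F := (finCongr hcard.symm).trans F.equivFin.symm
  let G : SimpleGraph (Fin n) := (subtreeGraph F).comap e
  let iso : G ≃g subtreeGraph F := ⟨e, Iff.rfl⟩
  have htree : G.IsTree := iso.isTree_iff.2 hF.isTree
  have hnbr : ∀ v, e '' G.neighborSet v = (subtreeGraph F).neighborSet (e v) := by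
    intro v
    ext a
    constructor
    · rintro ⟨u, hu, rfl⟩
      exact hu
    · intro ha
      refine ⟨e.symm a, ?_, by simp⟩
      change (subtreeGraph F).Adj (e v) (e (e.symm a))
      simpa using ha
  have hcardnbr : ∀ v, (G.neighborSet v).encard =
      ((subtreeGraph F).neighborSet (e v)).encard := fun v => by
    rw [← hnbr, e.injective.encard_image]
  have hfull : ∀ v, (e v).1.length < R → ∀ i, adjWord i (e v).1 ∈ F := fun v hv i =>
    hball (mem_ball.2 ⟨reduced_adjWord i (hF.reduced _ (e v).2),
      (length_adjWord_le _ _).trans hv⟩)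
  have hG : 𝒢 G := by
    rcases h𝒢 with h | ⟨hex, h⟩
    · refine h G htree ⟨fun v => ?_, e.symm ⟨[], hF.nil_mem⟩, ?_⟩
      · rw [hcardnbr]
        exact encard_neighborSet_le hF _
      · rw [hcardnbr]
        refine encard_neighborSet_eq hF (hfull _ ?_)
        simp; lia
    · refine h G ⟨htree, fun v => ?_⟩
      rw [hcardnbr]
      exact ((hreg hex).isRegularTree hF).2 (e v)
  have hport : ∀ v, ∃ (d : ℕ) (p : Fin d ≃ G.neighborSet v), (e v).1.length < R →
      d = Δ ∧ ∀ (i : Fin d) (j : Fin Δ), (i : ℕ) = j → (e (p i).1).1 = adjWord j (e v).1 := by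
    intro v
    by_cases hv : (e v).1.length < R
    · let f : Fin Δ → G.neighborSet v := fun i => ⟨e.symm ⟨_, hfull v hv i⟩, by
        change (subtreeGraph F).Adj (e v) (e (e.symm _))
        rw [Equiv.apply_symm_apply, subtreeGraph_adj_iff hF]
        exact ⟨i, rfl⟩⟩
      have hf : Function.Bijective f := by
        constructor
        · intro i j hij
          refine adjWord_injective (hF.reduced _ (e v).2) ?_
          simpa [f] using hij
        · rintro ⟨u, hu⟩
          obtain ⟨i, hi⟩ := (subtreeGraph_adj_iff hF).1
            (show (subtreeGraph F).Adj (e v) (e u) from hu)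
          refine ⟨i, ?_⟩
          simp only [f, Subtype.mk.injEq, Equiv.symm_apply_eq]
          exact Subtype.ext hi.symm
      refine ⟨Δ, Equiv.ofBijective f hf, fun _ => ⟨rfl, fun i j hij => ?_⟩⟩
      obtain rfl : i = j := Fin.ext hij
      simp [f]
    · exact ⟨_, (Fintype.equivFin (G.neighborSet v)).symm, fun h => (hv h).elim⟩
  choose d p hp using hport
  exact ⟨{
    graph := G
    deg := d
    port := p
    word := fun v => (e v).1
    word_injective := Subtype.val_injective.comp e.injective
    word_reduced := fun v => hF.reduced _ (e v).2
    exists_word := fun w hw hl => ⟨e.symm ⟨w, hball (mem_ball.2 ⟨hw, hl⟩)⟩, by simp⟩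
    deg_eq := fun v hv => (hp v hv).1
    word_port := fun v hv => (hp v hv).2 }, hG⟩

namespace Host

variable {R n M : ℕ} (h : Host Δ R n)

/-- The identifiers that are given by a labelling of the ball. -/
def ident (x : List (Fin Δ) → Fin M) (v : Fin n) : ℕ :=
  if (h.word v).length ≤ R then x (h.word v) + 1 else M + 1 + v

lemma ident_injective {x : List (Fin Δ) → Fin M}
    (hx : ∀ w w', Reduced w → Reduced w' → w.length ≤ R → w'.length ≤ R → x w = x w' → w = w') :
    Function.Injective (h.ident x) := by
  intro u v huv
  have h1 := (x (h.word u)).2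
  have h2 := (x (h.word v)).2
  simp only [ident] at huv
  split_ifs at huv with hu hv hv
  · exact h.word_injective (hx _ _ (h.word_reduced u) (h.word_reduced v) hu hv
      (Fin.ext (by lia)))
  · lia
  · lia
  · exact Fin.ext (by lia)

lemma ident_pos (x : List (Fin Δ) → Fin M) (v : Fin n) : 1 ≤ h.ident x v := by
  simp only [ident]
  split_ifs <;> lia

lemma ident_le (x : List (Fin Δ) → Fin M) (v : Fin n) : h.ident x v ≤ M + n := by
  have h1 := (x (h.word v)).2
  have h2 := v.2
  simp only [ident]
  split_ifs <;> lia

/-- The host with identifiers that are given by a labelling of the ball. -/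
def network (x : List (Fin Δ) → Fin M)
    (hx : ∀ w w', Reduced w → Reduced w' → w.length ≤ R → w'.length ≤ R → x w = x w' → w = w') :
    Network n where
  graph := h.graph
  deg := h.deg
  port := h.port
  ident := h.ident x
  ident_injective := h.ident_injective hx
  ident_pos := h.ident_pos x

end Host

/-! ### Simulating an algorithm on the infinite tree -/

variable {V In Out : Type}

/-- The states of an algorithm on the infinite tree, where the nodes know their labels only. -/
def treeState (Δ : ℕ) (A : LocalAlgorithm In Out) (inp : V → In) :
    ℕ → (List (Fin Δ) → V) → A.State
  | 0, x => A.init (inp (x []))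
  | T + 1, x => A.receive Δ (treeState Δ A inp T x)
      fun i => A.send (treeState Δ A inp T (reroot i x)) i

lemma treeState_congr (A : LocalAlgorithm In Out) (inp : V → In) {T : ℕ}
    {x y : List (Fin Δ) → V} (h : Agree T x y) :
    treeState Δ A inp T x = treeState Δ A inp T y := by
  induction T generalizing x y with
  | zero => simp [treeState, h [] (by simp [Reduced]) (by simp)]
  | succ T ih =>
    simp only [treeState]
    rw [ih (h.mono (by lia))]
    simp only [fun i => ih (h.reroot i)]

lemma receive_congr (A : LocalAlgorithm In Out) {d d' : ℕ} (hd : d = d') (s : A.State)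
    {m : Fin d → A.Msg} {m' : Fin d' → A.Msg}
    (hm : ∀ (i : Fin d) (j : Fin d'), (i : ℕ) = j → m i = m' j) :
    A.receive d s m = A.receive d' s m' := by
  subst hd
  congr 1
  funext i
  exact hm i i rfl

section simulation

variable {R n M : ℕ} (h : Host Δ R n) (x : List (Fin Δ) → Fin M)
  (hx : ∀ w w', Reduced w → Reduced w' → w.length ≤ R → w'.length ≤ R → x w = x w' → w = w')

/-- Inside the ball both ends number an edge by its colour. Hence a message carries no port
information beyond the edge colouring. -/
lemma val_revPort {v : Fin n} (hv : (h.word v).length < R) (i : Fin (h.deg v))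
    (hu : (h.word ((h.network x hx).nbr v i)).length < R) :
    ((h.network x hx).revPort v i : ℕ) = i := by
  set N := h.network x hx
  set u := N.nbr v i
  set k : Fin (h.deg u) := N.revPort v i
  have hport : (h.port u k).1 = v := by
    change ((N.port (N.nbr v i)) (N.revPort v i)).1 = v
    simp [Network.revPort]
  have h1 := h.word_port u hu k (Fin.cast (h.deg_eq u hu) k) rfl
  have h2 : h.word u = adjWord (Fin.cast (h.deg_eq v hv) i) (h.word v) :=
    h.word_port v hv i _ rfl
  rw [hport] at h1
  have h3 := adjWord_adjWord (Fin.cast (h.deg_eq v hv) i) (h.word_reduced v)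
  rw [← h2, h1] at h3
  have h4 : adjWord (Fin.cast (h.deg_eq u hu) k) (h.word u) =
      adjWord (Fin.cast (h.deg_eq v hv) i) (h.word u) := by
    rw [← h1]
    rw [← h1] at h3
    exact h3.symm
  have h5 := adjWord_injective (h.word_reduced u) h4
  simpa using congrArg Fin.val h5

lemma stateAfter_eq_treeState (A : LocalAlgorithm In Out) (inp : Fin n → In) (inp' : Fin M → In)
    (hinp : ∀ v, (h.word v).length < R → inp v = inp' (x (h.word v))) (T : ℕ) (v : Fin n)
    (hv : (h.word v).length + T < R) :
    A.stateAfter (h.network x hx) inp T v = treeState Δ A inp' T (shift (h.word v) x) := by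
  induction T generalizing v with
  | zero =>
    simp only [LocalAlgorithm.stateAfter, treeState]
    rw [hinp v (by lia), shift_apply_of_reduced (by simpa using h.word_reduced v),
      List.append_nil]
  | succ T ih =>
    simp only [LocalAlgorithm.stateAfter, treeState]
    rw [ih v (by lia)]
    refine receive_congr A (h.deg_eq v (by lia)) _ fun i j hij => ?_
    have hw : h.word ((h.network x hx).nbr v i) = adjWord j (h.word v) :=
      h.word_port v (by lia) i j hij
    have hl := length_adjWord_le j (h.word v)
    rw [ih _ (by rw [hw]; lia), val_revPort h x hx (by lia) i (by rw [hw]; lia), hij, hw,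
      treeState_congr A inp' (agree_shift_adjWord T j (h.word_reduced v) x)]

end simulation

/-- No algorithm computes a ruling set in few rounds on all networks that are given by a host and
by labellings of the ball. -/
theorem exists_not_isSolution [NeZero Δ] {M : ℕ} {H : Fin Δ → Fin M → Fin M → Prop}
    {U : Set (Fin M)} (hext : ∀ a ∈ U, ∀ i, ∃ b ∈ U, H i a b)
    (hpig : ∀ φ : Fin M → Fin Δ × Option (Fin Δ),
      ∃ a ∈ U, ∃ b ∈ U, H (φ a).1 a b ∧ φ a = φ b)
    (hH : ∀ i a b, H i a b → H i b a) {α c β T n : ℕ}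
    (hΔ : c * (α + 1) * (T + β + 1 + β).choose β ≤ Δ)
    (hg : NoShortCycle H (2 * (T + β + 2))) (h : Host Δ (T + β + 2) n)
    (A : LocalAlgorithm In (NodeOutput c)) (f : ℕ → ℕ → In) :
    ∃ x : List (Fin Δ) → Fin M, ∃ hx, ¬ (h.network x hx).IsSolution α c β
      (A.outputAfter (h.network x hx) (fun v => f (h.ident x v) (h.deg v)) T) := by
  by_contra hcon
  push Not at hcon
  have hinj : ∀ x, IsLabelling H x → ∀ w w', Reduced w → Reduced w' → w.length ≤ T + β + 2 →
      w'.length ≤ T + β + 2 → x w = x w' → w = w' :=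
    fun x hx w w' h1 h2 h3 h4 h5 => hx.eq_of_eq hH hg h1 h2 h3 h4 h5
  let inp' : Fin M → In := fun a => f (a + 1) Δ
  let o : (List (Fin Δ) → Fin M) → NodeOutput c := fun x => A.output (treeState Δ A inp' T x)
  have ho : ∀ x y, Agree T x y → o x = o y := fun x y hxy => by
    simp only [o, treeState_congr A inp' hxy]
  have hsim : ∀ (x : List (Fin Δ) → Fin M) hx v, (h.word v).length + T < T + β + 2 →
      A.outputAfter (h.network x hx) (fun v => f (h.ident x v) (h.deg v)) T v =
        o (shift (h.word v) x) := by
    intro x hx v hv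
    simp only [LocalAlgorithm.outputAfter, o]
    rw [stateAfter_eq_treeState h x hx A _ inp' ?_ T v hv]
    intro v hv
    simp only [Host.ident, if_pos hv.le, h.deg_eq v hv, inp']
  have hout : ∀ (x : List (Fin Δ) → Fin M) hx u v, (h.word v).length < T + β + 2 → ∀ j, h.word u = adjWord j (h.word v) →
      ∀ q : NodeOutput c, (∃ i : Fin ((h.network x hx).deg v), (h.network x hx).nbr v i = u ∧
        q.out i = true) ↔ q.out j = true := by
    intro x hx u v hv j hu q
    constructor
    · rintro ⟨i, rfl, hi⟩
      have := h.word_port v hv i (Fin.cast (h.deg_eq v hv) i) rfl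
      have h2 := adjWord_injective (h.word_reduced v) (this.symm.trans hu)
      rw [← h2]
      exact hi
    · intro hj
      refine ⟨Fin.cast (h.deg_eq v hv).symm j, h.word_injective ?_, hj⟩
      rw [hu]
      exact h.word_port v hv _ j rfl
  obtain ⟨root, hroot⟩ := h.exists_word [] (by simp [Reduced]) (by simp)
  have hnb : ∀ j : Fin Δ, ∃ u, h.word u = [j] := fun j =>
    h.exists_word [j] (by simp [Reduced]) (by simp)
  choose nb hnb using hnb
  have hadj : ∀ (x : List (Fin Δ) → Fin M) hx j, (h.network x hx).graph.Adj root (nb j) := by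
    intro x hx j
    have h1 := h.word_port root (by simp [hroot]) (Fin.cast (h.deg_eq root (by simp [hroot])).symm j)
      j rfl
    have h2 : (h.port root (Fin.cast (h.deg_eq root (by simp [hroot])).symm j)).1 = nb j :=
      h.word_injective (by rw [h1, hnb, hroot]; simp [adjWord])
    rw [← h2]
    exact (h.port root _).2
  have hosim : ∀ (x : List (Fin Δ) → Fin M) hx, A.outputAfter (h.network x hx)
      (fun v => f (h.ident x v) (h.deg v)) T root = o x := fun x hx => by
    rw [hsim x hx root (by rw [hroot]; simp; lia), hroot, shift_nil]
  have hosim' : ∀ (x : List (Fin Δ) → Fin M) hx j, A.outputAfter (h.network x hx)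
      (fun v => f (h.ident x v) (h.deg v)) T (nb j) = o (reroot j x) := fun x hx j => by
    rw [hsim x hx (nb j) (by rw [hnb]; simp; lia), hnb, shift_cons, shift_nil]
  refine not_rulingSet (α := α) hext hpig hH hΔ (col := fun x => (o x).color)
    (out := fun x i => (o x).out i = true)
    (fun x y _ _ hxy => by simp only [ho x y hxy]) (fun x y _ _ hxy => by simp only [ho x y hxy])
    ?_ ?_ ?_
  · intro x hx i h1 h2
    have hx' := hinj x hx
    have := (hcon x hx').oriented root (nb i) (hadj x hx' i)
      (by rw [hosim]; exact h1) (by rw [hosim']; exact h2)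
    rw [hosim, hosim', hout x hx' (nb i) root (by simp [hroot]) i (by simp [hnb, hroot, adjWord]),
      hout x hx' root (nb i) (by simp [hnb]) i (by simp [hnb, hroot, adjWord])] at this
    exact this.or
  · intro x hx a ha
    have hx' := hinj x hx
    have hnbinj : Function.Injective nb := by
      intro i j hij
      have := congrArg h.word hij
      rw [hnb, hnb] at this
      simpa using this
    refine le_trans ?_ ((hcon x hx').arbdefect root a (by rw [hosim]; exact ha))
    rw [← hnbinj.encard_image]
    refine Set.encard_le_encard ?_
    rintro _ ⟨i, ⟨h1, h2⟩, rfl⟩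
    refine ⟨hadj x hx' i, ?_, by rw [hosim']; exact h2⟩
    rw [hosim, hout x hx' (nb i) root (by simp [hroot]) i (by simp [hnb, hroot, adjWord])]
    exact h1
  · intro x hx
    have hx' := hinj x hx
    by_cases hc : (o x).color = none
    · obtain ⟨u, hu, p, hp⟩ := (hcon x hx').dominated root (by rw [hosim]; exact hc)
      -- The length bound keeps the whole walk where ports are edge colours and outputs are those of
      -- the infinite tree, so a walk to the ruling set can be copied there step by step.
      have key : ∀ v u (p : (h.network x hx').graph.Walk v u),
          (h.word v).length + p.length + T < T + β + 2 →
          (A.outputAfter (h.network x hx') (fun v => f (h.ident x v) (h.deg v)) T u).color ≠ none →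
          Near (fun y => (o y).color ≠ none) p.length (shift (h.word v) x) := by
        intro v u p
        induction p with
        | nil =>
          intro hl hu
          rw [hsim x hx' _ (by simpa using hl)] at hu
          exact hu
        | cons hvw p ih =>
          rename_i v w u
          intro hl hu
          rw [SimpleGraph.Walk.length_cons] at hl ⊢
          obtain ⟨i, hi⟩ := (h.port v).surjective ⟨w, hvw⟩
          have hw := h.word_port v (by lia) i (Fin.cast (h.deg_eq v (by lia)) i) rfl
          rw [hi] at hw
          have hlen := length_adjWord_le (Fin.cast (h.deg_eq v (by lia)) i) (h.word v)
          have := ih (by simp only at hw; rw [hw]; lia) hu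
          refine Or.inr ⟨Fin.cast (h.deg_eq v (by lia)) i, ?_⟩
          simp only at hw
          rw [hw] at this
          refine (near_congr hH (T := T) (fun y z _ _ hyz => by rw [ho y z hyz]) _
            (hx.shift hH _) ((hx.shift hH _).reroot hH _)
            (agree_shift_adjWord _ _ (h.word_reduced v) x)).1 this
      have := key root u p (by rw [hroot]; simp; lia) hu
      rw [hroot, shift_nil] at this
      exact this.mono hp
    · exact Near.mono (k := 0) (Nat.zero_le _) hc

end RegTree

/-! ### The lower bounds -/

namespace RegTree

instance (n : ℕ) : IsProbabilityMeasure (randomBits n) := by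
  unfold randomBits
  infer_instance

/-- The bits of some of the nodes are distributed like the bits of a smaller set of nodes. -/
lemma map_randomBits {m n : ℕ} {idx : Fin n → Fin m} (hidx : Function.Injective idx) :
    (randomBits m).map (fun ω v => ω (idx v)) = randomBits n := by
  classical
  have hmeas : Measurable fun (ω : Fin m → ℕ → Bool) (v : Fin n) => ω (idx v) :=
    measurable_pi_lambda _ fun v => measurable_pi_apply _
  symm
  unfold randomBits
  refine Measure.pi_eq fun s hs => ?_
  rw [Measure.map_apply hmeas (MeasurableSet.univ_pi hs)]
  have hpre : (fun (ω : Fin m → ℕ → Bool) (v : Fin n) => ω (idx v)) ⁻¹' Set.univ.pi s =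
      Set.univ.pi fun k => {b | ∀ v, idx v = k → b ∈ s v} := by
    ext ω
    simp only [Set.mem_preimage, Set.mem_univ_pi, Set.mem_ofPred_eq]
    exact ⟨fun h k v hv => hv ▸ h v, fun h v => h _ v rfl⟩
  rw [hpre, Measure.pi_pi]
  have h1 : ∀ v, {b | ∀ u, idx u = idx v → b ∈ s u} = s v := fun v => by
    ext b
    exact ⟨fun h => h v rfl, fun h u hu => hidx hu ▸ h⟩
  rw [← Finset.prod_subset (Finset.subset_univ (Finset.univ.image idx)) ?_,
    Finset.prod_image hidx.injOn]
  · simp only [h1]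
  · intro k _ hk
    have : {b : ℕ → Bool | ∀ v, idx v = k → b ∈ s v} = Set.univ := by
      refine Set.eq_univ_of_forall fun b v hv => ?_
      exact (hk (Finset.mem_image.2 ⟨v, Finset.mem_univ _, hv⟩)).elim
    rw [this, measure_univ]

/-- Only an inequality is claimed because `S` need not be measurable; the failure event of an
arbitrary algorithm is covered as well. -/
lemma randomBits_preimage_le {m n : ℕ} {idx : Fin n → Fin m} (hidx : Function.Injective idx)
    (S : Set (Fin n → ℕ → Bool)) :
    randomBits m {ω | (fun v => ω (idx v)) ∈ S} ≤ randomBits n S := by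
  have hmeas : Measurable fun (ω : Fin m → ℕ → Bool) (v : Fin n) => ω (idx v) :=
    measurable_pi_lambda _ fun v => measurable_pi_apply _
  rw [← map_randomBits hidx]
  exact Measure.le_map_apply hmeas.aemeasurable S

/-! ### The two lower bounds and their constants -/

variable {Δ α c β T n κ : ℕ} {𝒢 : SimpleGraph (Fin n) → Prop}

lemma idGraph_size_le {M : ℕ} (hΔ : 2 ≤ Δ) (hM : M ≤ Δ ^ (14 * (2 * (T + β + 2)) + 27))
    (hn : Δ ^ (2 * T + β + 50) ≤ n) (hκ : 31 ≤ κ) : M + n ≤ n ^ κ := by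
  have hn2 : 2 ≤ n := by
    calc 2 ≤ Δ := hΔ
      _ = Δ ^ 1 := (pow_one _).symm
      _ ≤ Δ ^ (2 * T + β + 50) := Nat.pow_le_pow_right (by lia) (by lia)
      _ ≤ n := hn
  have h1 : M ≤ n ^ 30 := by
    calc M ≤ Δ ^ (14 * (2 * (T + β + 2)) + 27) := hM
      _ ≤ Δ ^ ((2 * T + β + 50) * 30) := Nat.pow_le_pow_right (by lia) (by lia)
      _ = (Δ ^ (2 * T + β + 50)) ^ 30 := pow_mul _ _ _
      _ ≤ n ^ 30 := Nat.pow_le_pow_left hn 30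
  calc M + n ≤ n ^ 30 + n ^ 30 := Nat.add_le_add h1 (Nat.le_self_pow (by lia) n)
    _ = 2 * n ^ 30 := by ring
    _ ≤ n * n ^ 30 := Nat.mul_le_mul_right _ hn2
    _ = n ^ 31 := by ring
    _ ≤ n ^ κ := Nat.pow_le_pow_right (by lia) hκ

theorem not_detSolvable (hΔ : 2 ≤ Δ) (hκ : 31 ≤ κ)
    (h𝒢 : (∀ G, G.IsTree → HasMaxDegree G Δ → 𝒢 G) ∨
      ((∃ G : SimpleGraph (Fin n), IsRegularTree G Δ) ∧ ∀ G, IsRegularTree G Δ → 𝒢 G))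
    (hn : Δ ^ (2 * T + β + 50) ≤ n) (hchoose : c * (α + 1) * (T + β + 1 + β).choose β ≤ Δ) :
    ¬ DetSolvable 𝒢 κ α c β T := by
  rintro ⟨A, hA⟩
  have : NeZero Δ := ⟨by lia⟩
  obtain ⟨M, hM, H, U, hH, hext, hpig, hg⟩ := exists_idGraph hΔ (2 * (T + β + 2))
  obtain ⟨h, hh⟩ := exists_host (R := T + β + 2) hΔ (by lia)
    ((Nat.pow_le_pow_right (by lia) (by lia)).trans hn) h𝒢
  obtain ⟨x, hx, hsol⟩ := exists_not_isSolution hext hpig hH hchoose hg h A fun a b => (a, b)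
  exact hsol (hA (h.network x hx) hh fun v =>
    (h.ident_le x v).trans (idGraph_size_le hΔ hM hn hκ))

theorem not_randSolvable (hΔ : 2 ≤ Δ) (hκ : 31 ≤ κ)
    (h𝒢 : (∀ G, G.IsTree → HasMaxDegree G Δ → 𝒢 G) ∨
      ((∃ G : SimpleGraph (Fin n), IsRegularTree G Δ) ∧ ∀ G, IsRegularTree G Δ → 𝒢 G))
    (hn : Δ ^ (2 * T + β + 50) ≤ n) (hchoose : c * (α + 1) * (T + β + 1 + β).choose β ≤ Δ)
    (hn' : (Δ ^ (14 * (2 * (T + β + 2)) + 27)) ^ Δ ^ (T + β + 2 + 1) < n) :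
    ¬ RandSolvable 𝒢 κ α c β T := by
  classical
  rintro ⟨A, hA⟩
  have : NeZero Δ := ⟨by lia⟩
  obtain ⟨M, hM, H, U, hH, hext, hpig, hg⟩ := exists_idGraph hΔ (2 * (T + β + 2))
  obtain ⟨h, hh⟩ := exists_host (R := T + β + 2) hΔ (by lia)
    ((Nat.pow_le_pow_right (by lia) (by lia)).trans hn) h𝒢
  -- The node with identifier `a` uses stream `a - 1`. For fixed `ω` this is a deterministic
  -- algorithm; on a fixed network the identifiers are distinct, so the nodes have independent
  -- streams as in the model.
  let f : (Fin (M + n) → ℕ → Bool) → ℕ → ℕ → ℕ × ℕ × (ℕ → Bool) := fun ω a b =>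
    (a, b, if ha : a - 1 < M + n then ω ⟨a - 1, ha⟩ else fun _ => false)
  let E : (ball Δ (T + β + 2) → Fin M) → Set (Fin (M + n) → ℕ → Bool) := fun g =>
    {ω | ∃ x hx, (∀ w : ball Δ (T + β + 2), x w = g w) ∧ ¬ (h.network x hx).IsSolution α c β
      (A.outputAfter (h.network x hx) (fun v => f ω (h.ident x v) (h.deg v)) T)}
  have hcover : Set.univ ⊆ ⋃ g, E g := by
    intro ω _
    obtain ⟨x, hx, hsol⟩ := exists_not_isSolution hext hpig hH hchoose hg h A (f ω)
    exact Set.mem_iUnion.2 ⟨fun w => x w, x, hx, fun _ => rfl, hsol⟩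
  have hE : ∀ g, randomBits (M + n) (E g) ≤ (n : ℝ≥0∞)⁻¹ := by
    intro g
    rcases (E g).eq_empty_or_nonempty with h0 | ⟨-, x, hx, hxg, -⟩
    · simp [h0]
    have hidx : ∀ v, h.ident x v - 1 < M + n := fun v => by
      have := h.ident_le x v
      have := h.ident_pos x v
      lia
    let idx : Fin n → Fin (M + n) := fun v => ⟨h.ident x v - 1, hidx v⟩
    have hidx_inj : Function.Injective idx := by
      intro u v huv
      have h1 := congrArg Fin.val huv
      have h2 := h.ident_pos x u
      have h3 := h.ident_pos x v
      simp only [idx] at h1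
      exact h.ident_injective hx (by lia)
    refine le_trans ?_ ((randomBits_preimage_le hidx_inj _).trans
      (hA (h.network x hx) hh fun v => (h.ident_le x v).trans (idGraph_size_le hΔ hM hn hκ)))
    refine measure_mono ?_
    rintro ω ⟨y, hy, hyg, hsol⟩
    -- The network depends on the labelling only through the ball, so the whole event for `g` is a
    -- failure on one single network.
    have hid : h.ident y = h.ident x := by
      funext v
      simp only [Host.ident]
      split_ifs with hv
      · have hmem : h.word v ∈ ball Δ (T + β + 2) := mem_ball.2 ⟨h.word_reduced v, hv⟩
        rw [hyg ⟨_, hmem⟩, hxg ⟨_, hmem⟩]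
      · rfl
    have hnet : h.network y hy = h.network x hx := by
      simp only [Host.network, hid]
    rw [hnet, hid] at hsol
    have hf : (fun v => f ω (h.ident x v) (h.deg v)) =
        fun v => ((h.network x hx).ident v, (h.network x hx).deg v, ω (idx v)) := by
      funext v
      simp only [f, dif_pos (hidx v), idx]
      rfl
    rw [hf] at hsol
    exact hsol
  have hMn : M ^ (ball Δ (T + β + 2)).card < n := by
    refine lt_of_le_of_lt ?_ hn'
    calc M ^ (ball Δ (T + β + 2)).card
        ≤ (Δ ^ (14 * (2 * (T + β + 2)) + 27)) ^ (ball Δ (T + β + 2)).card :=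
          Nat.pow_le_pow_left hM _
      _ ≤ _ := Nat.pow_le_pow_right (by positivity) (card_ball_le hΔ _)
  have hn0 : (n : ℝ≥0∞) ≠ 0 := by
    have : n ≠ 0 := by lia
    exact_mod_cast this
  have h1 : (1 : ℝ≥0∞) ≤ (M ^ (ball Δ (T + β + 2)).card : ℕ) * (n : ℝ≥0∞)⁻¹ := by
    calc (1 : ℝ≥0∞) = randomBits (M + n) Set.univ := measure_univ.symm
      _ ≤ randomBits (M + n) (⋃ g, E g) := measure_mono hcover
      _ ≤ ∑ g, randomBits (M + n) (E g) := measure_iUnion_fintype_le _ _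
      _ ≤ ∑ _g : ball Δ (T + β + 2) → Fin M, (n : ℝ≥0∞)⁻¹ := Finset.sum_le_sum fun g _ => hE g
      _ = _ := by simp
  rw [← div_eq_mul_inv, ENNReal.le_div_iff_mul_le (Or.inl hn0) (Or.inl (by simp)), one_mul] at h1
  exact absurd (by exact_mod_cast h1) hMn.not_ge

/-- With `m` the minimum, `T < (m - β) / 4` and `m - β ≥ 100` give `2 * T + β + 50 ≤ m`. In
particular `T + β` lies strictly below the supremum, so some admissible `t ≥ T + β + 1` exists, and
the binomial coefficient is monotone. -/
lemma bounds_of_minReal {L : ℝ} (hc : 1 ≤ c) (hC : 100 ≤ minReal (largestT Δ α c β) L - β)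
    (hT : (T : ℝ) < 1 / 4 * (minReal (largestT Δ α c β) L - β)) :
    ((2 * T + β + 50 : ℕ) : ℝ) ≤ L ∧ c * (α + 1) * (T + β + 1 + β).choose β ≤ Δ := by
  set m := minReal (largestT Δ α c β) L with hm
  have hmβ : (2 * T + β + 50 : ℝ) ≤ m := by linarith
  constructor
  · have : m ≤ L := by
      rw [hm, minReal]
      split_ifs
      exacts [le_rfl, min_le_right _ _]
    push_cast
    linarith
  · have hlt : ((T + β : ℕ) : ℕ∞) < largestT Δ α c β := by
      by_cases htop : largestT Δ α c β = ⊤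
      · rw [htop]
        exact ENat.natCast_lt_top _
      · have h1 : m ≤ ((largestT Δ α c β).toNat : ℝ) := by
          rw [hm, minReal, if_neg htop]
          exact min_le_left _ _
        rw [← ENat.natCast_toNat htop]
        have h2 : ((T + β : ℕ) : ℝ) < ((largestT Δ α c β).toNat : ℝ) := by
          push_cast
          have : (0 : ℝ) ≤ T := T.cast_nonneg
          linarith
        exact_mod_cast h2
    simp only [largestT, lt_iSup_iff, Set.mem_ofPred_eq] at hlt
    obtain ⟨t, ht, hTt⟩ := hlt
    have hTt' : T + β < t := by exact_mod_cast hTt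
    rw [lt_div_iff₀ (by positivity)] at ht
    have h3 : (t + β).choose β * (c * (α + 1)) < Δ := by exact_mod_cast ht
    have h4 : (T + β + 1 + β).choose β ≤ (t + β).choose β := Nat.choose_le_choose _ (by lia)
    calc c * (α + 1) * (T + β + 1 + β).choose β ≤ c * (α + 1) * (t + β).choose β := by gcongr
      _ = (t + β).choose β * (c * (α + 1)) := by ring
      _ ≤ Δ := h3.le

lemma pow_le_of_le_logb (hΔ : 2 ≤ Δ) {k : ℕ} {y : ℝ} (hk : 1 ≤ k) (hy : 0 ≤ y)
    (h : (k : ℝ) ≤ Real.logb Δ y) : (Δ : ℝ) ^ k ≤ y := by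
  have hy0 : 0 < y := by
    refine hy.lt_of_ne fun h0 => ?_
    rw [← h0, Real.logb_zero] at h
    have : (1 : ℝ) ≤ k := by exact_mod_cast hk
    linarith
  rw [Real.le_logb_iff_rpow_le (by exact_mod_cast hΔ) hy0, Real.rpow_natCast] at h
  exact h

/-- The logarithm of the left side is at most `Δ` times its total exponent, because `Δ ≤ exp Δ`. The
linear factor in `T` and `β` is absorbed by `Δ ^ 7 * Δ ^ T * Δ`, the last factor using `β + 1 ≤ Δ`,
which gives `Δ ^ (2 * T + β + 12)`. -/
lemma count_lt_of_le_log (hΔ : 2 ≤ Δ) (hβ : β + 1 ≤ Δ)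
    (hn : (Δ : ℝ) ^ (2 * T + β + 50) ≤ Real.log n) :
    (Δ ^ (14 * (2 * (T + β + 2)) + 27)) ^ Δ ^ (T + β + 2 + 1) < n := by
  have hn0 : (0 : ℝ) < n := by
    rcases Nat.eq_zero_or_pos n with rfl | h
    · have : (0 : ℝ) < (Δ : ℝ) ^ (2 * T + β + 50) := by positivity
      simp at hn
      linarith
    · exact_mod_cast h
  have hT : T + 1 ≤ Δ ^ T := (Nat.lt_two_pow_self (n := T)).trans_le (Nat.pow_le_pow_left hΔ T)
  have h7 : 128 ≤ Δ ^ 7 := (Nat.pow_le_pow_left hΔ 7 : 2 ^ 7 ≤ Δ ^ 7)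
  have hlin : 14 * (2 * (T + β + 2)) + 27 ≤ 128 * ((T + 1) * (β + 1)) := by
    have h : (T + 1) * (β + 1) = T * β + T + β + 1 := by ring
    rw [h]
    generalize T * β = q
    lia
  have key : Δ * ((14 * (2 * (T + β + 2)) + 27) * Δ ^ (T + β + 2 + 1)) < Δ ^ (2 * T + β + 50) := by
    calc Δ * ((14 * (2 * (T + β + 2)) + 27) * Δ ^ (T + β + 2 + 1))
        ≤ Δ * ((128 * ((T + 1) * (β + 1))) * Δ ^ (T + β + 2 + 1)) := by
          exact Nat.mul_le_mul_left _ (Nat.mul_le_mul_right _ hlin)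
      _ ≤ Δ * ((Δ ^ 7 * (Δ ^ T * Δ)) * Δ ^ (T + β + 2 + 1)) := by gcongr
      _ = Δ ^ (2 * T + β + 12) := by ring
      _ < Δ ^ (2 * T + β + 50) := Nat.pow_lt_pow_right (by lia) (by lia)
  have hΔexp : (Δ : ℝ) ≤ Real.exp Δ := by linarith [Real.add_one_le_exp (Δ : ℝ)]
  set a := 14 * (2 * (T + β + 2)) + 27
  set b := Δ ^ (T + β + 2 + 1)
  have h1 : (((Δ ^ a) ^ b : ℕ) : ℝ) < n := by
    rw [← Real.exp_log hn0]
    calc (((Δ ^ a) ^ b : ℕ) : ℝ) = (Δ : ℝ) ^ (a * b) := by push_cast; rw [← pow_mul]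
      _ ≤ Real.exp Δ ^ (a * b) := by gcongr
      _ = Real.exp ((Δ * (a * b) : ℕ) : ℝ) := by
        rw [← Real.exp_nat_mul]
        push_cast
        ring_nf
      _ < Real.exp (Real.log n) := by
        refine Real.exp_lt_exp.2 (lt_of_lt_of_le ?_ hn)
        exact_mod_cast key
  exact_mod_cast h1

end RegTree

theorem mainTheorem1 :
    ∃ ε : ℝ, 0 < ε ∧ ∃ C : ℝ, ∃ κ₀ : ℕ, ∀ κ : ℕ, κ₀ ≤ κ →
      ∀ Δ α c β n : ℕ, 2 ≤ Δ → 1 ≤ c →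
      ∀ 𝒢 : SimpleGraph (Fin n) → Prop,
        ((∀ G, G.IsTree → HasMaxDegree G Δ → 𝒢 G) ∨
          ((∃ G : SimpleGraph (Fin n), IsRegularTree G Δ) ∧ ∀ G, IsRegularTree G Δ → 𝒢 G)) →
        (∀ T : ℕ, DetSolvable 𝒢 κ α c β T →
          C ≤ minReal (largestT Δ α c β) (Real.logb Δ n) - β →
          ε * (minReal (largestT Δ α c β) (Real.logb Δ n) - β) ≤ T) ∧
        (∀ T : ℕ, RandSolvable 𝒢 κ α c β T →
          C ≤ minReal (largestT Δ α c β) (Real.logb Δ (Real.log n)) - β →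
          ε * (minReal (largestT Δ α c β) (Real.logb Δ (Real.log n)) - β) ≤ T) := by
  refine ⟨1 / 4, by norm_num, 100, 31, fun κ hκ Δ α c β n hΔ hc 𝒢 h𝒢 => ⟨?_, ?_⟩⟩
  · intro T hdet hC
    by_contra! hT
    obtain ⟨hL, hchoose⟩ := RegTree.bounds_of_minReal hc hC hT
    have hn := RegTree.pow_le_of_le_logb hΔ (by lia) n.cast_nonneg hL
    exact RegTree.not_detSolvable hΔ hκ h𝒢 (by exact_mod_cast hn) hchoose hdet
  · intro T hrand hC
    by_contra! hT
    obtain ⟨hL, hchoose⟩ := RegTree.bounds_of_minReal hc hC hT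
    have hn := RegTree.pow_le_of_le_logb hΔ (by lia) (Real.log_natCast_nonneg n) hL
    have hn' : (Δ : ℝ) ^ (2 * T + β + 50) ≤ n :=
      hn.trans (Real.log_le_self n.cast_nonneg)
    have hβ : β + 1 ≤ Δ := by
      calc β + 1 = (β + 1).choose β := by simp
        _ ≤ (T + β + 1 + β).choose β := Nat.choose_le_choose _ (by lia)
        _ = 1 * (T + β + 1 + β).choose β := (one_mul _).symm
        _ ≤ c * (α + 1) * (T + β + 1 + β).choose β := by
          gcongr
          exact Nat.mul_pos hc (Nat.succ_pos α)
        _ ≤ Δ := hchoose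
    exact RegTree.not_randSolvable hΔ hκ h𝒢 (by exact_mod_cast hn') hchoose
      (RegTree.count_lt_of_le_log hΔ hβ hn) hrand
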